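/- There exist absolute constants $K,c>0$ such that the following holds for all integers $k,m,r\ge 1$, $n\ge 0$, $T\ge 0$ and all real matrices $A\in\mathbb{R}^{n\times n}$, $B\in\mathbb{R}^{n\times m}$, $C\in\mathbb{R}^{r\times n}$, $D\in\mathbb{R}^{r\times m}$. Consider the system $x_{t+1}=Ax_t+Bu_t+w_t$, $y_t=Cx_t+Du_t$ $(t\ge 0)$ with random initial state $x_0$. Let $\gamma>0$, and let the inputs $u_0,u_1,\dots$ be i.i.d. $N(0,\gamma^2 I_m)$. Suppose that the attacks occur with probability $0\le p<\frac{1}{4k-2}$: there are independent Bernoulli($p$) variables $\xi_0,\xi_1,\dots$ such that each $\xi_t$ is independent of the $\sigma$-algebra generated by $x_0,w_0,\dots,w_{t-1}$, and $w_t=0$ whenever $\xi_t=0$; apart from this the random vectors $w_t$ are arbitrary. Suppose also that the sequence $(\xi_t)_{t\ge0}$ is independent of the sequence $(u_t)_{t\ge0}$. Put $q=1-(1-p)^{2k-1}$ (so $q<\frac12$), $$\mathbf{U}_t^{(k)}=[u_t^T\ u_{t-1}^T\ \cdots\ u_{t-2k+1}^T]^T\in\mathbb{R}^{2km},\qquad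 v_t=\sum_{j=1}^{2k-1}CA^{j-1}w_{t-j}\in\mathbb{R}^r,$$ let $v_t^i$ be the $i$-th entry of $v_t$, and let $\mathbb{I}\{E\}$ be $1$ if the event $E$ occurs and $-1$ otherwise. Let $\delta\in(0,1]$ and suppose $$T\ \ge\ K\,\frac{k}{(1-2q)^2}\,\max\Bigl\{1,\ km\log\Bigl(\frac{km}{1-2q}\Bigr)+\log\Bigl(\frac r\delta\Bigr)\Bigr\}.$$ Then $c\,\gamma(1-2q)T>0$ and, with probability at least $1-\delta$, both of the following hold: (i) for all $s\in\mathbb{R}^{2km}$ with $\|s\|_2=1$ and all $i\in\{1,\dots,r\}$, $$\sum_{t=2k-1}^{T+2k-2}\mathbb{I}\{v_t^i=0\}\,|s^T\mathbf{U}_t^{(k)}|\ \ge\ c\,\gamma(1-2q)T;$$ (ii) if $A^{2k-1}=0$, then the Markov parameter matrix $G_k^*=[D\ \ CB\ \ CAB\ \cdots\ CA^{2k-2}B]$ is the unique minimizer over $G\in\mathbb{R}^{r\times 2km}$ of $\sum_{t=2k-1}^{T+2k-2}\|y_t-G\mathbf{U}_t^{(k)}\|_1$. -/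

import Mathlib

open MeasureTheory ProbabilityTheory
open scoped Matrix

noncomputable section

/-- The two-valued indicator of an event: `1` if the event occurs and `-1` otherwise. -/
def signIndicator (P : Prop) : ℝ :=
  open Classical in if P then 1 else -1

/-- The state trajectory `x_{t+1} = A x_t + B u_t + w_t`, started at `x0`. -/
def stateTraj {n m : ℕ} (A : Matrix (Fin n) (Fin n) ℝ) (B : Matrix (Fin n) (Fin m) ℝ)
    (x0 : Fin n → ℝ) (u : ℕ → EuclideanSpace ℝ (Fin m)) (w : ℕ → Fin n → ℝ) :
    ℕ → Fin n → ℝ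
  | 0 => x0
  | t + 1 => A *ᵥ stateTraj A B x0 u w t + B *ᵥ (u t).ofLp + w t

/-- The observation `y_t = C x_t + D u_t`. -/
def observation {n m r : ℕ} (A : Matrix (Fin n) (Fin n) ℝ) (B : Matrix (Fin n) (Fin m) ℝ)
    (C : Matrix (Fin r) (Fin n) ℝ) (D : Matrix (Fin r) (Fin m) ℝ)
    (x0 : Fin n → ℝ) (u : ℕ → EuclideanSpace ℝ (Fin m)) (w : ℕ → Fin n → ℝ) (t : ℕ) :
    Fin r → ℝ :=
  C *ᵥ stateTraj A B x0 u w t + D *ᵥ (u t).ofLp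

/-- The stacked input vector `[u_tᵀ, u_{t-1}ᵀ, …, u_{t-2k+1}ᵀ]ᵀ ∈ ℝ^{2km}`, whose coordinates are
indexed by (lag, input channel). It is used only for `t ≥ 2k - 1`. -/
def stackedInput {m : ℕ} (k : ℕ) (u : ℕ → EuclideanSpace ℝ (Fin m)) (t : ℕ) :
    EuclideanSpace ℝ (Fin (2 * k) × Fin m) :=
  WithLp.toLp 2 fun j => u (t - j.1) j.2

/-- The attack term `v_t = [C, CA, …, CA^{2k-2}] [w_{t-1}ᵀ, …, w_{t-2k+1}ᵀ]ᵀ`.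
It is used only for `t ≥ 2k - 1`. -/
def attackTerm {n r : ℕ} (k : ℕ) (A : Matrix (Fin n) (Fin n) ℝ) (C : Matrix (Fin r) (Fin n) ℝ)
    (w : ℕ → Fin n → ℝ) (t : ℕ) : Fin r → ℝ :=
  ∑ j ∈ Finset.range (2 * k - 1), (C * A ^ j) *ᵥ w (t - 1 - j)

/-- The Markov parameter matrix `[D, CB, CAB, …, CA^{2k-2}B]`, whose columns are indexed by
(block, input channel). -/
def markovMatrix {n m r : ℕ} (k : ℕ) (A : Matrix (Fin n) (Fin n) ℝ)
    (B : Matrix (Fin n) (Fin m) ℝ) (C : Matrix (Fin r) (Fin n) ℝ)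
    (D : Matrix (Fin r) (Fin m) ℝ) : Matrix (Fin r) (Fin (2 * k) × Fin m) ℝ :=
  Matrix.of fun i j =>
    if j.1.val = 0 then D i j.2 else (C * A ^ (j.1.val - 1) * B) i j.2

/-- The `ℓ₁` objective `∑_{t=2k-1}^{T+2k-2} ‖y_t - G U_t‖₁`. -/
def l1Loss {m r : ℕ} (k T : ℕ) (u : ℕ → EuclideanSpace ℝ (Fin m)) (y : ℕ → Fin r → ℝ)
    (G : Matrix (Fin r) (Fin (2 * k) × Fin m) ℝ) : ℝ :=
  ∑ t ∈ Finset.Icc (2 * k - 1) (T + 2 * k - 2),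
    ∑ i, |y t i - (G *ᵥ (stackedInput k u t).ofLp) i|

/-- The set of all solutions of the `ℓ₁`-norm estimator. -/
def l1Solutions {m r : ℕ} (k T : ℕ) (u : ℕ → EuclideanSpace ℝ (Fin m)) (y : ℕ → Fin r → ℝ) :
    Set (Matrix (Fin r) (Fin (2 * k) × Fin m) ℝ) :=
  {G | ∀ G', l1Loss k T u y G ≤ l1Loss k T u y G'}

/-- The σ-algebra `F_t` generated by `x_0, w_0, …, w_{t-1}`. -/
@[reducible]
def attackHistory {Ω : Type*} {n : ℕ} (x0 : Ω → Fin n → ℝ) (w : ℕ → Ω → Fin n → ℝ) (t : ℕ) :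
    MeasurableSpace Ω :=
  MeasurableSpace.comap x0 inferInstance ⊔
    ⨆ j ∈ Finset.range t, MeasurableSpace.comap (w j) inferInstance

/-- Attacks with probability `p` at each time: the `ξ_t` are independent Bernoulli(`p`) variables,
each `ξ_t` is independent of the past `F_t`, and there is no attack at time `t` when `ξ_t = 0`.
The attack vectors are otherwise arbitrary. -/
structure IsProbabilisticAttack {Ω : Type*} [MeasurableSpace Ω] {n : ℕ} (μ : Measure Ω)
    (p : unitInterval) (x0 : Ω → Fin n → ℝ) (w : ℕ → Ω → Fin n → ℝ) (ξ : ℕ → Ω → ℕ) :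
    Prop where
  measurable_init : Measurable x0
  measurable_attack : ∀ t, Measurable (w t)
  measurable_time : ∀ t, Measurable (ξ t)
  hasLaw : ∀ t, HasLaw (ξ t) (bernoulliMeasure 1 0 p) μ
  iIndep : iIndepFun ξ μ
  indep_history : ∀ t, Indep (MeasurableSpace.comap (ξ t) inferInstance) (attackHistory x0 w t) μ
  eq_zero : ∀ t ω, ξ t ω = 0 → w t ω = 0

/-- The inputs `u_0, u_1, …` are i.i.d. with law `N(0, γ² I_m)`. -/
structure IsGaussianInput {Ω : Type*} [MeasurableSpace Ω] {m : ℕ} (μ : Measure Ω) (γ : ℝ)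
    (u : ℕ → Ω → EuclideanSpace ℝ (Fin m)) : Prop where
  measurable : ∀ t, Measurable (u t)
  hasLaw : ∀ t, HasLaw (u t) (multivariateGaussian 0 (γ ^ 2 • (1 : Matrix (Fin m) (Fin m) ℝ))) μ
  iIndep : iIndepFun u μ

end

/-
Normalized by `γ`, the inner product of a unit vector `s` with a stacked input is a standard
Gaussian independent of the sign of its window, and that sign has mean at least `β = 1 - 2q`.
Writing `exp (-θ a |z|) = cosh (θ z) - a sinh (θ |z|)` for a sign `a` shows that the signed
absolute value has drift at least a constant times `β`. Windows whose starting times are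
congruent modulo `2k` are disjoint, hence independent, so a Chernoff bound in each of the `2k`
residue classes bounds the signed sum in the direction `s` from below, and the same argument
with the sign `-1` bounds the unsigned sum from above. A net of `exp (O(km log (km / β)))`
directions makes the lower bound uniform in `s`. If `A ^ (2k - 1) = 0`, then
`y_t = G* U_t + v_t`, and the excess of the `ℓ₁` loss at `G` over its value at `G*` is at least
the total signed sum over the rows of `G - G*`, which is positive.
-/

open scoped Finset

section Independence

variable {Ω ι : Type*} [MeasurableSpace Ω] {μ : Measure Ω}

theorem iIndepFun_prodMk_of_rectangles {α β : Type*} [MeasurableSpace α] [MeasurableSpace β]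
    {X : ι → Ω → α} {Y : ι → Ω → β} (mX : ∀ i, Measurable (X i)) (mY : ∀ i, Measurable (Y i))
    (h : ∀ (S : Finset ι) (a : ι → Set α) (b : ι → Set β), (∀ i, MeasurableSet (a i)) →
      (∀ i, MeasurableSet (b i)) → μ (⋂ i ∈ S, X i ⁻¹' a i ∩ Y i ⁻¹' b i) =
        ∏ i ∈ S, μ (X i ⁻¹' a i ∩ Y i ⁻¹' b i)) :
    iIndepFun (fun i ω => (X i ω, Y i ω)) μ := by
  rw [iIndepFun_iff_iIndep]
  refine iIndepSets.iIndep (fun i => ((mX i).prodMk (mY i)).comap_le)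
    (fun i => {s | ∃ t ∈ Set.image2 (· ×ˢ ·) {a : Set α | MeasurableSet a}
      {b : Set β | MeasurableSet b}, (fun ω => (X i ω, Y i ω)) ⁻¹' t = s})
    (fun i => isPiSystem_prod.comap _) (fun i => ?_) ?_
  · rw [← generateFrom_prod, MeasurableSpace.comap_generateFrom]
    rfl
  · rw [iIndepSets_iff]
    intro S f hf
    have rectangle : ∀ i, ∃ a : Set α, ∃ b : Set β, MeasurableSet a ∧ MeasurableSet b ∧
        (i ∈ S → f i = X i ⁻¹' a ∩ Y i ⁻¹' b) := by
      intro i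
      by_cases hi : i ∈ S
      · obtain ⟨t, ⟨a, ha, b, hb, rfl⟩, ht⟩ := hf i hi
        exact ⟨a, b, ha, hb, fun _ => ht.symm⟩
      · exact ⟨∅, ∅, .empty, .empty, fun h => absurd h hi⟩
    choose a b ha hb hab using rectangle
    rw [Set.iInter₂_congr hab, Finset.prod_congr rfl fun i hi => by rw [hab i hi]]
    exact h S a b ha hb

theorem iIndepFun_prodMk_of_indepFun {α β : Type*} [MeasurableSpace α] [MeasurableSpace β]
    {X : ι → Ω → α} {Y : ι → Ω → β} (mX : ∀ i, Measurable (X i)) (mY : ∀ i, Measurable (Y i))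
    (hX : iIndepFun X μ) (hY : iIndepFun Y μ)
    (hXY : IndepFun (fun ω i => X i ω) (fun ω i => Y i ω) μ) :
    iIndepFun (fun i ω => (X i ω, Y i ω)) μ := by
  refine iIndepFun_prodMk_of_rectangles mX mY fun S a b ha hb => ?_
  have hsplit : μ ((⋂ i ∈ S, X i ⁻¹' a i) ∩ ⋂ i ∈ S, Y i ⁻¹' b i) =
      μ (⋂ i ∈ S, X i ⁻¹' a i) * μ (⋂ i ∈ S, Y i ⁻¹' b i) := by
    have hA : MeasurableSet (⋂ i ∈ S, (fun x : ι → α => x i) ⁻¹' a i) :=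
      Finset.measurableSet_biInter _ fun i _ => measurable_pi_apply i (ha i)
    have hB : MeasurableSet (⋂ i ∈ S, (fun y : ι → β => y i) ⁻¹' b i) :=
      Finset.measurableSet_biInter _ fun i _ => measurable_pi_apply i (hb i)
    have h := hXY.measure_inter_preimage_eq_mul _ _ hA hB
    simp only [Set.preimage_iInter₂] at h
    exact h
  have hpair (i : ι) : μ (X i ⁻¹' a i ∩ Y i ⁻¹' b i) = μ (X i ⁻¹' a i) * μ (Y i ⁻¹' b i) :=
    (hXY.comp (measurable_pi_apply i) (measurable_pi_apply i)).measure_inter_preimage_eq_mul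
      _ _ (ha i) (hb i)
  simp only [Set.iInter_inter_distrib, hsplit, hpair, Finset.prod_mul_distrib]
  rw [hX.measure_inter_preimage_eq_mul S fun i _ => ha i,
    hY.measure_inter_preimage_eq_mul S fun i _ => hb i]

theorem iIndepFun_sigma_curry {κ : ι → Type*} {𝓧 : (i : ι) → κ i → Type*}
    [∀ i j, MeasurableSpace (𝓧 i j)] {X : (p : (i : ι) × κ i) → Ω → 𝓧 p.1 p.2}
    (mX : ∀ p, Measurable (X p)) (hX : iIndepFun X μ) :
    iIndepFun (fun i ω (j : κ i) => X ⟨i, j⟩ ω) μ := by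
  have := hX.isProbabilityMeasure
  have hprob : ∀ i j, IsProbabilityMeasure (μ.map (X ⟨i, j⟩)) :=
    fun i j => Measure.isProbabilityMeasure_map (mX _).aemeasurable
  have hblock : ∀ i, iIndepFun (fun j : κ i => X ⟨i, j⟩) μ :=
    fun i => hX.precomp (g := fun j : κ i => (⟨i, j⟩ : (i : ι) × κ i)) sigma_mk_injective
  have hcurry : (fun ω i (j : κ i) => X ⟨i, j⟩ ω) =
      MeasurableEquiv.piCurry 𝓧 ∘ fun ω p => X p ω := by
    ext
    simp [Sigma.curry]
  rw [iIndepFun_iff_map_fun_eq_infinitePi_map fun i => measurable_pi_lambda _ fun j => mX _,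
    hcurry, ← Measure.map_map (by fun_prop) (measurable_pi_lambda _ mX),
    hX.map_fun_eq_infinitePi_map mX, Measure.infinitePi_map_piCurry fun i j => μ.map (X ⟨i, j⟩)]
  congr with i
  rw [(hblock i).map_fun_eq_infinitePi_map fun j => mX _]

theorem iIndepFun_of_dependsOn {κ α β : Type*} [MeasurableSpace α] [MeasurableSpace β]
    {Z : ι → Ω → α} (mZ : ∀ i, Measurable (Z i)) (hZ : iIndepFun Z μ) {S : κ → Set ι}
    (hS : Pairwise (Function.onFun Disjoint S)) {F : κ → (ι → α) → β}
    (mF : ∀ a, Measurable (F a)) (hF : ∀ a, DependsOn (F a) (S a)) :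
    iIndepFun (fun a ω => F a fun i => Z i ω) μ := by
  classical
  have := hZ.isProbabilityMeasure
  obtain ⟨ω₀⟩ := nonempty_of_isProbabilityMeasure μ
  have hinj : Function.Injective fun p : (a : κ) × S a => (p.2 : ι) := by
    rintro ⟨a, i, hi⟩ ⟨b, j, hj⟩ rfl
    obtain rfl : a = b := by
      by_contra hab
      exact Set.disjoint_left.1 (hS hab) hi hj
    rfl
  have hblocks : iIndepFun (fun a ω (i : S a) => Z i ω) μ :=
    iIndepFun_sigma_curry (κ := fun a => S a) (𝓧 := fun _ _ => α)
      (X := fun p : (a : κ) × S a => Z p.2) (fun p => mZ _)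
      (hZ.precomp (g := fun p : (a : κ) × S a => (p.2 : ι)) hinj)
  let extend (a : κ) (z : S a → α) (i : ι) : α := if hi : i ∈ S a then z ⟨i, hi⟩ else Z i ω₀
  have mextend (a : κ) : Measurable (extend a) := by
    refine measurable_pi_lambda _ fun i => ?_
    by_cases hi : i ∈ S a <;> simp only [extend, hi, dite_true, dite_false] <;> fun_prop
  refine (hblocks.comp (fun a => F a ∘ extend a) fun a => (mF a).comp (mextend a)).congr
    fun a => Filter.Eventually.of_forall fun ω => hF a fun i hi => ?_
  simp [extend, hi]

end Independence

section Chernoff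

theorem sum_range_eq_sum_residues {M : Type*} [AddCommMonoid M] {L : ℕ} (hL : 0 < L) (T : ℕ)
    (f : ℕ → M) :
    ∑ i ∈ Finset.range T, f i =
      ∑ j ∈ Finset.range L, ∑ a ∈ Finset.range T with j + L * a < T, f (j + L * a) := by
  rw [Finset.sum_sigma']
  refine Finset.sum_nbij' (fun i => ⟨i % L, i / L⟩) (fun p => p.1 + L * p.2) ?_ ?_ ?_ ?_ ?_
  · intro i hi
    simp only [Finset.mem_sigma, Finset.mem_filter, Finset.mem_range] at hi ⊢
    exact ⟨Nat.mod_lt _ hL, (Nat.div_le_self _ _).trans_lt hi, by rwa [Nat.mod_add_div]⟩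
  · rintro ⟨j, a⟩ h
    simp only [Finset.mem_sigma, Finset.mem_filter, Finset.mem_range] at h ⊢
    exact h.2.2
  · exact fun i _ => Nat.mod_add_div i L
  · rintro ⟨j, a⟩ h
    simp only [Finset.mem_sigma, Finset.mem_range] at h
    simp [Nat.mod_eq_of_lt h.1, Nat.add_mul_div_left _ _ hL, Nat.div_eq_of_lt h.1]
  · simp [Nat.mod_add_div]

theorem div_le_card_residue {L : ℕ} {j : ℕ} (hj : j < L) (T : ℕ) :
    T / L ≤ #{a ∈ Finset.range T | j + L * a < T} := by
  have hsub : Finset.range (T / L) ⊆ {a ∈ Finset.range T | j + L * a < T} := by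
    intro a ha
    have hblock : (a + 1) * L ≤ T := (Nat.le_div_iff_mul_le (by omega)).1 (Finset.mem_range.1 ha)
    have ha_le : a ≤ L * a := Nat.le_mul_of_pos_left _ (by omega)
    simp only [Finset.mem_filter, Finset.mem_range]
    constructor <;> nlinarith
  simpa using Finset.card_le_card hsub

variable {Ω : Type*} [MeasurableSpace Ω] {μ : Measure Ω}

theorem measureReal_sum_nonpos_le_pow_card {ι : Type*} {X : ι → Ω → ℝ}
    (mX : ∀ i, Measurable (X i)) (hX : iIndepFun X μ) {θ ρ : ℝ} (hθ : 0 ≤ θ)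
    (hint : ∀ i, Integrable (fun ω => Real.exp (-θ * X i ω)) μ)
    (hmgf : ∀ i, mgf (X i) μ (-θ) ≤ ρ) (s : Finset ι) :
    μ.real {ω | ∑ i ∈ s, X i ω ≤ 0} ≤ ρ ^ #s := by
  have := hX.isProbabilityMeasure
  have hchernoff := measure_le_le_exp_mul_mgf 0 (neg_nonpos.2 hθ)
    (hX.integrable_exp_mul_sum mX (s := s) fun i _ => hint i)
  rw [hX.mgf_sum mX] at hchernoff
  simp only [mul_zero, Real.exp_zero, one_mul, Finset.sum_apply] at hchernoff
  exact hchernoff.trans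
    ((Finset.prod_le_prod (fun _ _ => mgf_nonneg) fun i _ => hmgf i).trans_eq (by simp))

theorem measureReal_sum_range_neg_le {L : ℕ} (hL : 0 < L) (T : ℕ) {X : ℕ → Ω → ℝ}
    (mX : ∀ i, Measurable (X i)) (hX : ∀ j, iIndepFun (fun a => X (j + L * a)) μ) {θ ρ : ℝ}
    (hθ : 0 ≤ θ) (hρ : ρ ≤ 1) (hint : ∀ i, Integrable (fun ω => Real.exp (-θ * X i ω)) μ)
    (hmgf : ∀ i, mgf (X i) μ (-θ) ≤ ρ) :
    μ.real {ω | ∑ i ∈ Finset.range T, X i ω < 0} ≤ L * ρ ^ (T / L) := by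
  have := (hX 0).isProbabilityMeasure
  let residue (j : ℕ) : Finset ℕ := {a ∈ Finset.range T | j + L * a < T}
  have hsub : {ω | ∑ i ∈ Finset.range T, X i ω < 0} ⊆
      ⋃ j ∈ Finset.range L, {ω | ∑ a ∈ residue j, X (j + L * a) ω ≤ 0} := by
    intro ω hω
    rw [Set.mem_ofPred_eq, sum_range_eq_sum_residues hL] at hω
    obtain ⟨j, hj, hneg⟩ :=
      Finset.exists_lt_of_sum_lt (hω.trans_eq (Finset.sum_const_zero (s := Finset.range L)).symm)
    exact Set.mem_biUnion hj hneg.le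
  have htail (j : ℕ) (hj : j ∈ Finset.range L) :
      μ.real {ω | ∑ a ∈ residue j, X (j + L * a) ω ≤ 0} ≤ ρ ^ (T / L) :=
    (measureReal_sum_nonpos_le_pow_card (fun a => mX _) (hX j) hθ (fun a => hint _)
      (fun a => hmgf _) _).trans
      (pow_le_pow_of_le_one (mgf_nonneg.trans (hmgf 0)) hρ
        (div_le_card_residue (Finset.mem_range.1 hj) T))
  calc μ.real {ω | ∑ i ∈ Finset.range T, X i ω < 0}
      ≤ ∑ j ∈ Finset.range L, μ.real {ω | ∑ a ∈ residue j, X (j + L * a) ω ≤ 0} :=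
        (measureReal_mono hsub (measure_ne_top _ _)).trans (measureReal_biUnion_finset_le _ _)
    _ ≤ ∑ _j ∈ Finset.range L, ρ ^ (T / L) := Finset.sum_le_sum htail
    _ = L * ρ ^ (T / L) := by simp

theorem pairwise_disjoint_Ico_add_mul (L j : ℕ) :
    Pairwise (Function.onFun Disjoint fun a => Set.Ico (j + L * a) (j + L * a + L)) := by
  have h : ∀ a b, a < b →
      Disjoint (Set.Ico (j + L * a) (j + L * a + L)) (Set.Ico (j + L * b) (j + L * b + L)) := by
    intro a b hab
    rw [Set.Ico_disjoint_Ico]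
    have : L * (a + 1) ≤ L * b := Nat.mul_le_mul_left L hab
    rw [mul_add_one] at this
    omega
  intro a b hab
  rcases hab.lt_or_gt with hlt | hgt
  exacts [h a b hlt, (h b a hgt).symm]

theorem measureReal_sum_window_neg_le {α : Type*} [MeasurableSpace α] {Z : ℕ → Ω → α}
    (mZ : ∀ t, Measurable (Z t)) (hZ : iIndepFun Z μ) {L : ℕ} (hL : 0 < L)
    {F : ℕ → (ℕ → α) → ℝ} (mF : ∀ i, Measurable (F i))
    (hF : ∀ i, DependsOn (F i) (Set.Ico i (i + L))) {θ ρ : ℝ} (hθ : 0 ≤ θ) (hρ : ρ ≤ 1)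
    (hint : ∀ i, Integrable (fun ω => Real.exp (-θ * F i fun t => Z t ω)) μ)
    (hmgf : ∀ i, mgf (fun ω => F i fun t => Z t ω) μ (-θ) ≤ ρ) (T : ℕ) :
    μ.real {ω | ∑ i ∈ Finset.range T, F i (fun t => Z t ω) < 0} ≤ L * ρ ^ (T / L) :=
  measureReal_sum_range_neg_le hL T (fun i => (mF i).comp (measurable_pi_lambda _ mZ))
    (fun j => iIndepFun_of_dependsOn mZ hZ (pairwise_disjoint_Ico_add_mul L j)
      (fun _ => mF _) fun _ => hF _) hθ hρ hint hmgf

end Chernoff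

section GaussianMoments

theorem integral_cos_gaussianReal : ∫ x, Real.cos x ∂gaussianReal 0 1 = Real.exp (-(1 / 2)) := by
  have hint : Integrable (fun x : ℝ => Complex.exp (x * Complex.I)) (gaussianReal 0 1) :=
    Integrable.of_bound (C := 1) (by fun_prop)
      (Filter.Eventually.of_forall fun x => (Complex.norm_exp_ofReal_mul_I x).le)
  have hchar : ∫ x : ℝ, Complex.exp (x * Complex.I) ∂gaussianReal 0 1 =
      (Real.exp (-(1 / 2)) : ℝ) := by
    have h := charFun_gaussianReal (μ := 0) (v := 1) 1
    rw [charFun_apply_real] at h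
    simpa [neg_div] using h
  calc ∫ x, Real.cos x ∂gaussianReal 0 1
      = ∫ x : ℝ, (Complex.exp (x * Complex.I)).re ∂gaussianReal 0 1 := by
        simp only [Complex.exp_ofReal_mul_I_re]
    _ = (∫ x : ℝ, Complex.exp (x * Complex.I) ∂gaussianReal 0 1).re := integral_re hint
    _ = Real.exp (-(1 / 2)) := by rw [hchar, Complex.ofReal_re]

theorem integrable_abs_gaussianReal : Integrable (fun x : ℝ => |x|) (gaussianReal 0 1) :=
  ((memLp_id_gaussianReal 1).integrable le_rfl).abs

theorem one_third_le_integral_abs_gaussianReal : 1 / 3 ≤ ∫ x, |x| ∂gaussianReal 0 1 := by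
  have hexp : Real.exp (-(1 / 2)) ≤ 2 / 3 := by
    rw [Real.exp_neg, inv_le_comm₀ (Real.exp_pos _) (by norm_num)]
    linarith [Real.add_one_le_exp (1 / 2 : ℝ)]
  have hcos : Integrable (fun x : ℝ => Real.cos x) (gaussianReal 0 1) :=
    Integrable.of_bound (C := 1) (by fun_prop) (Filter.Eventually.of_forall Real.abs_cos_le_one)
  calc (1 / 3 : ℝ) ≤ 1 - Real.exp (-(1 / 2)) := by linarith
    _ = ∫ x, (1 - Real.cos x) ∂gaussianReal 0 1 := by
        rw [integral_sub (integrable_const _) hcos, integral_cos_gaussianReal]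
        simp
    _ ≤ ∫ x, |x| ∂gaussianReal 0 1 := by
        refine integral_mono ((integrable_const _).sub hcos) integrable_abs_gaussianReal fun x => ?_
        simpa using (le_abs_self _).trans (Real.abs_cos_sub_cos_le 0 x)

theorem integrable_cosh_mul_gaussianReal (θ : ℝ) :
    Integrable (fun x => Real.cosh (θ * x)) (gaussianReal 0 1) := by
  simp only [Real.cosh_eq, ← neg_mul]
  exact ((integrable_exp_mul_gaussianReal θ).add (integrable_exp_mul_gaussianReal (-θ))).div_const 2

theorem integral_cosh_mul_gaussianReal (θ : ℝ) :
    ∫ x, Real.cosh (θ * x) ∂gaussianReal 0 1 = Real.exp (θ ^ 2 / 2) := by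
  have hmgf (t : ℝ) : ∫ x, Real.exp (t * x) ∂gaussianReal 0 1 = Real.exp (t ^ 2 / 2) := by
    simpa [mgf] using congrFun (mgf_id_gaussianReal (μ := 0) (v := 1)) t
  simp only [Real.cosh_eq, ← neg_mul]
  rw [integral_div, integral_add (integrable_exp_mul_gaussianReal θ)
    (integrable_exp_mul_gaussianReal (-θ)), hmgf, hmgf, neg_sq]
  ring

theorem cosh_mul_abs (θ x : ℝ) : Real.cosh (θ * |x|) = Real.cosh (θ * x) := by
  rw [← Real.cosh_abs (θ * |x|), ← Real.cosh_abs (θ * x), abs_mul, abs_mul, abs_abs]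

theorem abs_sinh_le_cosh (x : ℝ) : |Real.sinh x| ≤ Real.cosh x := by
  rw [Real.abs_sinh, ← Real.cosh_abs]
  exact (Real.sinh_lt_cosh _).le

theorem integrable_sinh_mul_abs_gaussianReal (θ : ℝ) :
    Integrable (fun x => Real.sinh (θ * |x|)) (gaussianReal 0 1) :=
  (integrable_cosh_mul_gaussianReal θ).mono' (by fun_prop) <| Filter.Eventually.of_forall fun x =>
    (abs_sinh_le_cosh _).trans_eq (cosh_mul_abs θ x)

theorem integral_sinh_mul_abs_gaussianReal_le (θ : ℝ) :
    ∫ x, Real.sinh (θ * |x|) ∂gaussianReal 0 1 ≤ Real.exp (θ ^ 2 / 2) := by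
  rw [← integral_cosh_mul_gaussianReal θ]
  exact integral_mono (integrable_sinh_mul_abs_gaussianReal θ) (integrable_cosh_mul_gaussianReal θ)
    fun x => (Real.sinh_lt_cosh _).le.trans_eq (cosh_mul_abs θ x)

theorem div_three_le_integral_sinh_mul_abs_gaussianReal {θ : ℝ} (hθ : 0 ≤ θ) :
    θ / 3 ≤ ∫ x, Real.sinh (θ * |x|) ∂gaussianReal 0 1 :=
  calc θ / 3 = θ * (1 / 3) := by ring
    _ ≤ θ * ∫ x, |x| ∂gaussianReal 0 1 :=
        mul_le_mul_of_nonneg_left one_third_le_integral_abs_gaussianReal hθ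
    _ = ∫ x, θ * |x| ∂gaussianReal 0 1 := (integral_const_mul _ _).symm
    _ ≤ ∫ x, Real.sinh (θ * |x|) ∂gaussianReal 0 1 :=
        integral_mono (integrable_abs_gaussianReal.const_mul θ)
          (integrable_sinh_mul_abs_gaussianReal θ) fun x =>
            Real.self_le_sinh_iff.2 (by positivity)

end GaussianMoments

section OneStep

variable {Ω : Type*} [MeasurableSpace Ω] {μ : Measure Ω} {Z a : Ω → ℝ} {β θ : ℝ}

theorem integrable_comp_of_hasLaw {α E : Type*} [MeasurableSpace α] [NormedAddCommGroup E]
    {ν : Measure α} {X : Ω → α} (hX : HasLaw X ν μ) {f : α → E} (hf : Integrable f ν) :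
    Integrable (fun ω => f (X ω)) μ :=
  Integrable.comp_aemeasurable (hX.map_eq.symm ▸ hf) hX.aemeasurable

theorem exp_neg_mul_sign_mul_abs {a : ℝ} (ha : a = 1 ∨ a = -1) (θ z : ℝ) :
    Real.exp (-θ * (a * |z|)) = Real.cosh (θ * z) - a * Real.sinh (θ * |z|) := by
  rw [← cosh_mul_abs]
  rcases ha with rfl | rfl
  · rw [one_mul, one_mul, Real.cosh_sub_sinh, neg_mul]
  · rw [neg_one_mul, neg_one_mul, sub_neg_eq_add, Real.cosh_add_sinh, neg_mul_neg]

theorem integrable_sign_mul_sinh_mul_abs (hZ : HasLaw Z (gaussianReal 0 1) μ) (ma : Measurable a)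
    (ha : ∀ ω, a ω = 1 ∨ a ω = -1) (θ : ℝ) :
    Integrable (fun ω => a ω * Real.sinh (θ * |Z ω|)) μ := by
  refine (integrable_comp_of_hasLaw hZ (integrable_sinh_mul_abs_gaussianReal θ)).bdd_mul (c := 1)
    ma.aestronglyMeasurable (Filter.Eventually.of_forall fun ω => ?_)
  rcases ha ω with h | h <;> simp [h]

theorem integrable_exp_sign_mul_abs (hZ : HasLaw Z (gaussianReal 0 1) μ) (ma : Measurable a)
    (ha : ∀ ω, a ω = 1 ∨ a ω = -1) (θ : ℝ) :
    Integrable (fun ω => Real.exp (-θ * (a ω * |Z ω|))) μ := by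
  simp only [exp_neg_mul_sign_mul_abs (ha _)]
  exact (integrable_comp_of_hasLaw hZ (integrable_cosh_mul_gaussianReal θ)).sub
    (integrable_sign_mul_sinh_mul_abs hZ ma ha θ)

theorem mgf_sign_mul_abs_eq (hZ : HasLaw Z (gaussianReal 0 1) μ) (ma : Measurable a)
    (ha : ∀ ω, a ω = 1 ∨ a ω = -1) (haZ : IndepFun a Z μ) (θ : ℝ) :
    mgf (fun ω => a ω * |Z ω|) μ (-θ) = Real.exp (θ ^ 2 / 2) -
      (∫ ω, a ω ∂μ) * ∫ x, Real.sinh (θ * |x|) ∂gaussianReal 0 1 := by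
  have hcosh : ∫ ω, Real.cosh (θ * Z ω) ∂μ = Real.exp (θ ^ 2 / 2) := by
    rw [← integral_cosh_mul_gaussianReal]
    exact hZ.integral_comp (f := fun x => Real.cosh (θ * x)) (by fun_prop)
  have hsinh : ∫ ω, Real.sinh (θ * |Z ω|) ∂μ = ∫ x, Real.sinh (θ * |x|) ∂gaussianReal 0 1 :=
    hZ.integral_comp (f := fun x => Real.sinh (θ * |x|)) (by fun_prop)
  have hmul : ∫ ω, a ω * Real.sinh (θ * |Z ω|) ∂μ =
      (∫ ω, a ω ∂μ) * ∫ ω, Real.sinh (θ * |Z ω|) ∂μ :=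
    (haZ.comp (φ := id) (ψ := fun x => Real.sinh (θ * |x|)) measurable_id
      (by fun_prop)).integral_fun_mul_eq_mul_integral ma.aestronglyMeasurable
      (integrable_comp_of_hasLaw hZ (integrable_sinh_mul_abs_gaussianReal θ)).aestronglyMeasurable
  simp only [mgf, exp_neg_mul_sign_mul_abs (ha _)]
  rw [integral_sub (integrable_comp_of_hasLaw hZ (integrable_cosh_mul_gaussianReal θ))
    (integrable_sign_mul_sinh_mul_abs hZ ma ha θ), hcosh, hmul, hsinh]

theorem exp_half_sq_le_one_add_sq (hθ : θ ^ 2 ≤ 1) : Real.exp (θ ^ 2 / 2) ≤ 1 + θ ^ 2 := by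
  refine (Real.exp_bound_div_one_sub_of_interval (by positivity) (by linarith)).trans ?_
  rw [div_le_iff₀ (by linarith)]
  nlinarith [sq_nonneg θ]

theorem mgf_sign_mul_abs_le (hZ : HasLaw Z (gaussianReal 0 1) μ) (ma : Measurable a)
    (ha : ∀ ω, a ω = 1 ∨ a ω = -1) (haZ : IndepFun a Z μ) (hβ : 0 ≤ β) (haβ : β ≤ ∫ ω, a ω ∂μ)
    (hθ0 : 0 ≤ θ) (hθ1 : θ ≤ 1) :
    mgf (fun ω => a ω * |Z ω|) μ (-θ) ≤ Real.exp (θ ^ 2 - β * (θ / 3)) := by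
  have hdrift : β * (θ / 3) ≤ (∫ ω, a ω ∂μ) * ∫ x, Real.sinh (θ * |x|) ∂gaussianReal 0 1 :=
    mul_le_mul haβ (div_three_le_integral_sinh_mul_abs_gaussianReal hθ0) (by positivity)
      (hβ.trans haβ)
  rw [mgf_sign_mul_abs_eq hZ ma ha haZ]
  linarith [exp_half_sq_le_one_add_sq (pow_le_one₀ (n := 2) hθ0 hθ1),
    Real.add_one_le_exp (θ ^ 2 - β * (θ / 3))]

theorem mgf_sub_const (X : Ω → ℝ) (c t : ℝ) :
    mgf (fun ω => X ω - c) μ t = mgf X μ t * Real.exp (-(t * c)) := by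
  simpa [sub_eq_add_neg] using mgf_add_const (X := X) (μ := μ) (t := t) (-c)

/- The quadratic `θ ^ 2 - β θ / 3 + β θ / 6` takes its minimum `-β ^ 2 / 144` at `θ = β / 12`. -/
theorem mgf_sign_mul_abs_sub_le (hZ : HasLaw Z (gaussianReal 0 1) μ) (ma : Measurable a)
    (ha : ∀ ω, a ω = 1 ∨ a ω = -1) (haZ : IndepFun a Z μ) (hβ0 : 0 ≤ β) (hβ1 : β ≤ 1)
    (haβ : β ≤ ∫ ω, a ω ∂μ) :
    mgf (fun ω => a ω * |Z ω| - β / 6) μ (-(β / 12)) ≤ Real.exp (-(β ^ 2 / 144)) :=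
  calc mgf (fun ω => a ω * |Z ω| - β / 6) μ (-(β / 12))
      = mgf (fun ω => a ω * |Z ω|) μ (-(β / 12)) * Real.exp (β / 12 * (β / 6)) := by
        rw [mgf_sub_const, neg_mul, neg_neg]
    _ ≤ Real.exp ((β / 12) ^ 2 - β * (β / 12 / 3)) * Real.exp (β / 12 * (β / 6)) := by
        gcongr
        exact mgf_sign_mul_abs_le hZ ma ha haZ hβ0 haβ (by positivity) (by linarith)
    _ = Real.exp (-(β ^ 2 / 144)) := by rw [← Real.exp_add]; ring_nf

theorem integrable_exp_sign_mul_abs_sub (hZ : HasLaw Z (gaussianReal 0 1) μ) (ma : Measurable a)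
    (ha : ∀ ω, a ω = 1 ∨ a ω = -1) (θ c : ℝ) :
    Integrable (fun ω => Real.exp (-θ * (a ω * |Z ω| - c))) μ := by
  have hfactor (ω : Ω) : Real.exp (-θ * (a ω * |Z ω| - c)) =
      Real.exp (-θ * (a ω * |Z ω|)) * Real.exp (θ * c) := by
    rw [← Real.exp_add]
    ring_nf
  simp only [hfactor]
  exact (integrable_exp_sign_mul_abs hZ ma ha θ).mul_const _

theorem mgf_neg_abs_sub_le [IsProbabilityMeasure μ] (hZ : HasLaw Z (gaussianReal 0 1) μ) :
    mgf (fun ω => -1 * |Z ω| - -3) μ (-1) ≤ Real.exp (-1) := by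
  have htwo : (2 : ℝ) ≤ Real.exp (3 / 2) := by linarith [Real.add_one_le_exp (3 / 2 : ℝ)]
  rw [mgf_sub_const, mgf_sign_mul_abs_eq (a := fun _ => -1) hZ measurable_const
    (fun _ => .inr rfl) (indepFun_const_left _ _)]
  calc (Real.exp (1 ^ 2 / 2) - (∫ _, -1 ∂μ) * ∫ x, Real.sinh (1 * |x|) ∂gaussianReal 0 1) *
        Real.exp (-(-1 * -3))
      ≤ (2 * Real.exp (1 ^ 2 / 2)) * Real.exp (-(-1 * -3)) := by
        refine mul_le_mul_of_nonneg_right ?_ (Real.exp_pos _).le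
        rw [integral_const, probReal_univ, one_smul]
        linarith [integral_sinh_mul_abs_gaussianReal_le 1]
    _ ≤ (Real.exp (3 / 2) * Real.exp (1 ^ 2 / 2)) * Real.exp (-(-1 * -3)) := by gcongr
    _ = Real.exp (-1) := by rw [← Real.exp_add, ← Real.exp_add]; norm_num

end OneStep

section GaussianWindow

variable {Ω : Type*} [MeasurableSpace Ω] {μ : Measure Ω} {m k : ℕ} {γ : ℝ}
  {u : ℕ → Ω → EuclideanSpace ℝ (Fin m)}

/-- The block of `s` that is paired with the input of lag `j` in `⟪s, stackedInput k u t⟫`. -/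
def lagBlock (s : EuclideanSpace ℝ (Fin (2 * k) × Fin m)) (j : Fin (2 * k)) :
    EuclideanSpace ℝ (Fin m) :=
  WithLp.toLp 2 fun c => s (j, c)

theorem inner_stackedInput (s : EuclideanSpace ℝ (Fin (2 * k) × Fin m))
    (v : ℕ → EuclideanSpace ℝ (Fin m)) (t : ℕ) :
    inner ℝ s (stackedInput k v t) = ∑ j, inner ℝ (lagBlock s j) (v (t - j)) := by
  simp [PiLp.inner_apply, stackedInput, lagBlock, Fintype.sum_prod_type]

theorem sum_norm_sq_lagBlock (s : EuclideanSpace ℝ (Fin (2 * k) × Fin m)) :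
    ∑ j, ‖lagBlock s j‖ ^ 2 = ‖s‖ ^ 2 := by
  simp [EuclideanSpace.norm_sq_eq, lagBlock, Fintype.sum_prod_type]

theorem measurable_inner_stackedInput (s : EuclideanSpace ℝ (Fin (2 * k) × Fin m)) (t : ℕ) :
    Measurable fun v : ℕ → EuclideanSpace ℝ (Fin m) => inner ℝ s (stackedInput k v t) := by
  simp only [inner_stackedInput]
  fun_prop

theorem dependsOn_inner_stackedInput (s : EuclideanSpace ℝ (Fin (2 * k) × Fin m)) (i : ℕ) :
    DependsOn (fun v : ℕ → EuclideanSpace ℝ (Fin m) =>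
      inner ℝ s (stackedInput k v (2 * k - 1 + i))) (Set.Ico i (i + 2 * k)) := by
  intro v v' h
  simp only [inner_stackedInput]
  refine Finset.sum_congr rfl fun j _ => ?_
  rw [h (2 * k - 1 + i - j) ⟨by omega, by omega⟩]

theorem charFun_map_inner {E : Type*} [NormedAddCommGroup E] [InnerProductSpace ℝ E]
    [MeasurableSpace E] [BorelSpace E] [SecondCountableTopology E] {X : Ω → E}
    (hX : Measurable X) (s : E) (x : ℝ) :
    charFun (μ.map fun ω => inner ℝ s (X ω)) x = charFun (μ.map X) (x • s) := by
  have hm : Measurable fun ω => inner ℝ s (X ω) := by fun_prop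
  rw [charFun_apply, charFun_apply, integral_map hm.aemeasurable (by fun_prop),
    integral_map hX.aemeasurable (by fun_prop)]
  simp [real_inner_comm, inner_smul_right]

theorem charFun_map_gaussianInput (hu : IsGaussianInput μ γ u) (t : ℕ)
    (x : EuclideanSpace ℝ (Fin m)) :
    charFun (μ.map (u t)) x = Complex.exp (-((γ ^ 2 * ‖x‖ ^ 2 / 2 : ℝ) : ℂ)) := by
  have hquad : x.ofLp ⬝ᵥ (γ ^ 2 • (1 : Matrix (Fin m) (Fin m) ℝ)) *ᵥ x.ofLp =
      γ ^ 2 * ‖x‖ ^ 2 := by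
    rw [Matrix.smul_mulVec, Matrix.one_mulVec, dotProduct_smul, EuclideanSpace.norm_sq_eq]
    simp [dotProduct, sq]
  rw [(hu.hasLaw t).map_eq,
    charFun_multivariateGaussian (Matrix.PosSemidef.one.smul (sq_nonneg γ)), hquad]
  simp

theorem iIndepFun_inner_lag (hu : IsGaussianInput μ γ u) {t : ℕ} (ht : 2 * k - 1 ≤ t)
    (x : Fin (2 * k) → EuclideanSpace ℝ (Fin m)) :
    iIndepFun (fun (j : Fin (2 * k)) ω => inner ℝ (x j) (u (t - j) ω)) μ := by
  have hinj : Function.Injective fun j : Fin (2 * k) => t - (j : ℕ) := by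
    intro i j hij
    simp only at hij
    omega
  exact (hu.iIndep.precomp hinj).comp (fun j v => inner ℝ (x j) v) fun j => by fun_prop

theorem hasLaw_sum_inner_lag (hu : IsGaussianInput μ γ u) {t : ℕ} (ht : 2 * k - 1 ≤ t)
    {x : Fin (2 * k) → EuclideanSpace ℝ (Fin m)} (hx : γ ^ 2 * ∑ j, ‖x j‖ ^ 2 = 1) :
    HasLaw (fun ω => ∑ j, inner ℝ (x j) (u (t - j) ω)) (gaussianReal 0 1) μ := by
  have := hu.iIndep.isProbabilityMeasure
  have mu := hu.measurable
  have hm : Measurable fun ω => ∑ j, inner ℝ (x j) (u (t - j) ω) := by fun_prop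
  have : IsProbabilityMeasure (μ.map fun ω => ∑ j, inner ℝ (x j) (u (t - j) ω)) :=
    Measure.isProbabilityMeasure_map hm.aemeasurable
  refine ⟨hm.aemeasurable, Measure.ext_of_charFun (funext fun y => ?_)⟩
  have hexponent : ∑ j, γ ^ 2 * ‖y • x j‖ ^ 2 / 2 = y ^ 2 / 2 := by
    simp only [norm_smul, mul_pow, Real.norm_eq_abs, sq_abs]
    rw [← Finset.sum_div, ← Finset.mul_sum, ← Finset.mul_sum, mul_left_comm, hx, mul_one]
  rw [(iIndepFun_inner_lag hu ht x).charFun_map_fun_sum_eq_prod fun j => by fun_prop,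
    Finset.prod_apply, charFun_gaussianReal]
  simp only [charFun_map_inner (mu _), charFun_map_gaussianInput hu]
  rw [← Complex.exp_sum, Finset.sum_neg_distrib, ← Complex.ofReal_sum, hexponent]
  simp

theorem hasLaw_inner_stackedInput (hu : IsGaussianInput μ γ u) (hγ : γ ≠ 0) {t : ℕ}
    (ht : 2 * k - 1 ≤ t) {s : EuclideanSpace ℝ (Fin (2 * k) × Fin m)} (hs : ‖s‖ = 1) :
    HasLaw (fun ω => inner ℝ s (stackedInput k (fun j => u j ω) t) / γ) (gaussianReal 0 1) μ := by
  have hunit : γ ^ 2 * ∑ j, ‖γ⁻¹ • lagBlock s j‖ ^ 2 = 1 := by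
    simp only [norm_smul, mul_pow, norm_inv, Real.norm_eq_abs, inv_pow, sq_abs]
    rw [← Finset.mul_sum, sum_norm_sq_lagBlock, hs]
    field_simp
  convert hasLaw_sum_inner_lag hu ht hunit using 2 with ω
  rw [inner_stackedInput, div_eq_inv_mul, Finset.mul_sum]
  simp only [real_inner_smul_left]

end GaussianWindow

section AttackSign

variable {Ω : Type*} [MeasurableSpace Ω] {μ : Measure Ω} {k : ℕ}

theorem signIndicator_eq_or (P : Prop) : signIndicator P = 1 ∨ signIndicator P = -1 := by
  unfold signIndicator
  split_ifs <;> simp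

theorem signIndicator_mono {P Q : Prop} (h : P → Q) : signIndicator P ≤ signIndicator Q := by
  by_cases hP : P
  · simp [signIndicator, hP, h hP]
  · by_cases hQ : Q <;> simp [signIndicator, hP, hQ]

theorem measurable_signIndicator {α : Type*} [MeasurableSpace α] {P : α → Prop}
    (hP : MeasurableSet {x | P x}) : Measurable fun x => signIndicator (P x) := by
  classical
  unfold signIndicator
  exact Measurable.ite hP measurable_const measurable_const

theorem integral_signIndicator [IsProbabilityMeasure μ] {P : Ω → Prop}
    (hP : MeasurableSet {ω | P ω}) :
    ∫ ω, signIndicator (P ω) ∂μ = 2 * μ.real {ω | P ω} - 1 := by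
  have hsign : (fun ω => signIndicator (P ω)) =
      fun ω => 2 * ({ω | P ω}.indicator 1 ω : ℝ) - 1 := by
    ext ω
    by_cases hω : P ω <;> simp [signIndicator, hω]; norm_num
  have hint : Integrable (fun ω => ({ω | P ω}.indicator 1 ω : ℝ)) μ :=
    (integrable_const (1 : ℝ)).indicator hP
  rw [hsign, integral_sub (hint.const_mul 2) (integrable_const _), integral_const_mul,
    integral_indicator_one hP]
  simp

/-- The sign attached to the `i`-th window: `1` if none of the times `i, …, i + 2k - 2` is an attack
time, and `-1` otherwise. These are the `2k - 1` times whose attacks enter `attackTerm` at time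
`2k - 1 + i`. -/
noncomputable def windowSign (k : ℕ) (x : ℕ → ℕ) (i : ℕ) : ℝ :=
  signIndicator (∀ l ∈ Finset.range (2 * k - 1), x (i + l) = 0)

theorem windowSign_eq_or (k : ℕ) (x : ℕ → ℕ) (i : ℕ) :
    windowSign k x i = 1 ∨ windowSign k x i = -1 :=
  signIndicator_eq_or _

theorem abs_windowSign (k : ℕ) (x : ℕ → ℕ) (i : ℕ) : |windowSign k x i| = 1 :=
  abs_eq zero_le_one |>.2 (windowSign_eq_or k x i)

theorem measurable_windowSign (k i : ℕ) : Measurable fun x => windowSign k x i := by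
  refine measurable_signIndicator ?_
  simp only [Set.ofPred_forall]
  exact Finset.measurableSet_biInter _ fun l _ =>
    measurable_pi_apply (i + l) (measurableSet_singleton 0)

theorem dependsOn_windowSign (k i : ℕ) :
    DependsOn (fun x => windowSign k x i) (Set.Ico i (i + 2 * k)) := by
  intro x x' h
  refine congrArg signIndicator (propext (forall₂_congr fun l hl => ?_))
  rw [h (i + l) ⟨by omega, by have := Finset.mem_range.1 hl; omega⟩]

theorem pow_le_measureReal_biInter {ι α : Type*} [MeasurableSpace α] {X : ι → Ω → α}
    (hX : iIndepFun X μ) {a : Set α} (ha : MeasurableSet a) {c : ℝ} (hc : 0 ≤ c)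
    (h : ∀ i, c ≤ μ.real (X i ⁻¹' a)) (s : Finset ι) :
    c ^ #s ≤ μ.real (⋂ i ∈ s, X i ⁻¹' a) := by
  rw [measureReal_def, hX.measure_inter_preimage_eq_mul s fun _ _ => ha, ENNReal.toReal_prod]
  exact (Finset.prod_const c).symm.trans_le (Finset.prod_le_prod (fun _ _ => hc) fun i _ => h i)

theorem le_integral_windowSign {ξ : ℕ → Ω → ℕ} (mξ : ∀ t, Measurable (ξ t)) (iξ : iIndepFun ξ μ)
    {p : ℝ} (hp : p ≤ 1) (hξ : ∀ t, 1 - p ≤ μ.real (ξ t ⁻¹' {0})) (k i : ℕ) :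
    2 * (1 - p) ^ (2 * k - 1) - 1 ≤ ∫ ω, windowSign k (fun t => ξ t ω) i ∂μ := by
  have := iξ.isProbabilityMeasure
  have hset : {ω | ∀ l ∈ Finset.range (2 * k - 1), ξ (i + l) ω = 0} =
      ⋂ l ∈ Finset.range (2 * k - 1), ξ (i + l) ⁻¹' {0} := by
    ext ω
    simp
  have hfree := pow_le_measureReal_biInter (X := fun l => ξ (i + l))
    (iξ.precomp (add_right_injective i)) (measurableSet_singleton 0) (sub_nonneg.2 hp)
    (fun l => hξ (i + l)) (Finset.range (2 * k - 1))
  rw [Finset.card_range] at hfree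
  unfold windowSign
  rw [integral_signIndicator, hset]
  · linarith
  · rw [hset]
    exact Finset.measurableSet_biInter _ fun l _ => mξ _ (measurableSet_singleton 0)

theorem attackTerm_eq_zero {n r : ℕ} (A : Matrix (Fin n) (Fin n) ℝ) (C : Matrix (Fin r) (Fin n) ℝ)
    {w : ℕ → Fin n → ℝ} {i : ℕ} (hw : ∀ l ∈ Finset.range (2 * k - 1), w (i + l) = 0) :
    attackTerm k A C w (2 * k - 1 + i) = 0 := by
  refine Finset.sum_eq_zero fun j hj => ?_
  have hindex : 2 * k - 1 + i - 1 - j = i + (2 * k - 1 - 1 - j) := by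
    have := Finset.mem_range.1 hj
    omega
  rw [hindex, hw _ (Finset.mem_range.2 (by have := Finset.mem_range.1 hj; omega)),
    Matrix.mulVec_zero]

theorem windowSign_le_signIndicator {n r : ℕ} (A : Matrix (Fin n) (Fin n) ℝ)
    (C : Matrix (Fin r) (Fin n) ℝ) {w : ℕ → Fin n → ℝ} {x : ℕ → ℕ} (hw : ∀ t, x t = 0 → w t = 0)
    (i : ℕ) (e : Fin r) :
    windowSign k x i ≤ signIndicator (attackTerm k A C w (2 * k - 1 + i) e = 0) :=
  signIndicator_mono fun hx => congrFun (attackTerm_eq_zero A C fun l hl => hw _ (hx l hl)) e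

end AttackSign

section SignedAbsSum

variable {κ E : Type*} [NormedAddCommGroup E] [InnerProductSpace ℝ E]

/-- The sum `∑ aₜ |⟪s, Uₜ⟫|` over `t ∈ I`. With `aₜ = ±1` recording whether the observation at time
`t` is uncorrupted, its positivity in every direction `s` is what the `ℓ₁` estimator needs. -/
noncomputable def signedAbsSum (I : Finset κ) (a : κ → ℝ) (U : κ → E) (s : E) : ℝ :=
  ∑ t ∈ I, a t * |inner ℝ s (U t)|

theorem signedAbsSum_smul (I : Finset κ) (a : κ → ℝ) (U : κ → E) (c : ℝ) (s : E) :
    signedAbsSum I a U (c • s) = |c| * signedAbsSum I a U s := by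
  simp only [signedAbsSum, real_inner_smul_left, abs_mul, Finset.mul_sum, mul_left_comm]

theorem signedAbsSum_mono {I : Finset κ} {a b : κ → ℝ} (h : ∀ t, a t ≤ b t) (U : κ → E) (s : E) :
    signedAbsSum I a U s ≤ signedAbsSum I b U s :=
  Finset.sum_le_sum fun t _ => mul_le_mul_of_nonneg_right (h t) (abs_nonneg _)

theorem signedAbsSum_pos {I : Finset κ} {a : κ → ℝ} {U : κ → E}
    (h : ∀ s, ‖s‖ = 1 → 0 < signedAbsSum I a U s) {s : E} (hs : s ≠ 0) :
    0 < signedAbsSum I a U s := by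
  have hunit := h (‖s‖⁻¹ • s) (norm_smul_inv_norm (𝕜 := ℝ) hs)
  rw [signedAbsSum_smul, abs_of_nonneg (by positivity)] at hunit
  exact pos_of_mul_pos_right hunit (by positivity)

theorem signedAbsSum_nonneg {I : Finset κ} {a : κ → ℝ} {U : κ → E}
    (h : ∀ s, ‖s‖ = 1 → 0 < signedAbsSum I a U s) (s : E) : 0 ≤ signedAbsSum I a U s := by
  rcases eq_or_ne s 0 with rfl | hs
  · simp [signedAbsSum]
  · exact (signedAbsSum_pos h hs).le

theorem signedAbsSum_sub_le {I : Finset κ} {a : κ → ℝ} (ha : ∀ t, |a t| = 1) (U : κ → E)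
    (x s : E) :
    signedAbsSum I a U x - signedAbsSum I a U s ≤ ∑ t ∈ I, |inner ℝ (s - x) (U t)| := by
  rw [signedAbsSum, signedAbsSum, ← Finset.sum_sub_distrib]
  refine Finset.sum_le_sum fun t _ => ?_
  calc a t * |inner ℝ x (U t)| - a t * |inner ℝ s (U t)|
      = a t * (|inner ℝ x (U t)| - |inner ℝ s (U t)|) := by ring
    _ ≤ |a t * (|inner ℝ x (U t)| - |inner ℝ s (U t)|)| := le_abs_self _
    _ = |(|inner ℝ x (U t)| - |inner ℝ s (U t)|)| := by rw [abs_mul, ha, one_mul]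
    _ ≤ |inner ℝ x (U t) - inner ℝ s (U t)| := abs_abs_sub_abs_le _ _
    _ = |inner ℝ (s - x) (U t)| := by rw [inner_sub_left, abs_sub_comm]

end SignedAbsSum

section Net

variable {ι : Type*} [Fintype ι] {N : ℕ}

theorem abs_inner_le_mul_sum_abs {x : EuclideanSpace ℝ ι} {h : ℝ} (hx : ∀ j, |x j| ≤ h)
    (y : EuclideanSpace ℝ ι) : |inner ℝ x y| ≤ h * ∑ j, |y j| := by
  rw [PiLp.inner_apply, Finset.mul_sum]
  refine (Finset.abs_sum_le_sum_abs _ _).trans (Finset.sum_le_sum fun j _ => ?_)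
  rw [RCLike.inner_apply, conj_trivial, mul_comm, abs_mul]
  exact mul_le_mul_of_nonneg_right (hx j) (abs_nonneg _)

theorem norm_le_card_mul {x : EuclideanSpace ℝ ι} {h : ℝ} (hx : ∀ j, |x j| ≤ h) :
    ‖x‖ ≤ Fintype.card ι * h := by
  calc ‖x‖ = ‖∑ j, x j • EuclideanSpace.basisFun ι ℝ j‖ :=
        congrArg norm ((EuclideanSpace.basisFun ι ℝ).sum_repr x).symm
    _ ≤ ∑ j, ‖x j • EuclideanSpace.basisFun ι ℝ j‖ := norm_sum_le _ _
    _ ≤ ∑ _j : ι, h := Finset.sum_le_sum fun j _ => by simpa [norm_smul] using hx j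
    _ = Fintype.card ι * h := by simp

/-- The points of the grid of mesh `1 / N` in the cube `[-1, 1]^ι`. -/
noncomputable def gridPoints (ι : Type*) [Fintype ι] (N : ℕ) : Finset (EuclideanSpace ℝ ι) :=
  open Classical in (Fintype.piFinset fun _ : ι => Finset.Icc (-(N : ℤ)) N).image
    fun g => WithLp.toLp 2 fun j => (g j : ℝ) / N

theorem card_gridPoints_le : #(gridPoints ι N) ≤ (2 * N + 1) ^ Fintype.card ι := by
  classical
  refine Finset.card_image_le.trans_eq ?_
  rw [Fintype.card_piFinset, Finset.prod_const, Int.card_Icc, Finset.card_univ]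
  congr 1
  omega

theorem exists_mem_gridPoints_abs_sub_le (hN : 0 < N) {s : EuclideanSpace ℝ ι} (hs : ‖s‖ ≤ 1) :
    ∃ x ∈ gridPoints ι N, ∀ j, |s j - x j| ≤ 1 / N := by
  classical
  have hN' : (0 : ℝ) < N := by exact_mod_cast hN
  refine ⟨WithLp.toLp 2 fun j => (⌊s j * N⌋ : ℝ) / N,
    Finset.mem_image_of_mem _ (Fintype.mem_piFinset.2 fun j => ?_), fun j => ?_⟩
  · obtain ⟨hlow, hupp⟩ := abs_le.1 ((PiLp.norm_apply_le s j).trans hs)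
    rw [Finset.mem_Icc, Int.le_floor, Int.floor_le_iff]
    push_cast
    constructor <;> nlinarith
  · have hfloor : s j - (⌊s j * N⌋ : ℝ) / N = Int.fract (s j * N) / N := by
      rw [Int.fract]
      field_simp
    rw [hfloor, abs_of_nonneg (div_nonneg (Int.fract_nonneg _) hN'.le)]
    exact div_le_div_of_nonneg_right (Int.fract_lt_one _).le hN'.le

/- The net consists of the normalized nonzero grid points; `ρ`, the norm of the grid point near `s`,
undoes the normalization. -/
theorem exists_unit_net (hN : 0 < N) (hdN : 2 * Fintype.card ι ≤ N) :
    ∃ S : Finset (EuclideanSpace ℝ ι), (∀ x ∈ S, ‖x‖ = 1) ∧ #S ≤ (2 * N + 1) ^ Fintype.card ι ∧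
      ∀ s : EuclideanSpace ℝ ι, ‖s‖ = 1 →
        ∃ x ∈ S, ∃ ρ ≥ (1 / 2 : ℝ), ∀ j, |(s - ρ • x) j| ≤ 1 / N := by
  classical
  have hN' : (0 : ℝ) < N := by exact_mod_cast hN
  refine ⟨{x ∈ gridPoints ι N | x ≠ 0}.image fun x => ‖x‖⁻¹ • x, ?_, ?_, fun s hs => ?_⟩
  · simp only [Finset.forall_mem_image, Finset.mem_filter]
    exact fun x hx => norm_smul_inv_norm (𝕜 := ℝ) hx.2
  · exact Finset.card_image_le.trans ((Finset.card_filter_le _ _).trans card_gridPoints_le)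
  · obtain ⟨x, hx, hnear⟩ := exists_mem_gridPoints_abs_sub_le hN hs.le
    have hdist : ‖s - x‖ ≤ 1 / 2 := by
      refine (norm_le_card_mul (x := s - x) hnear).trans ?_
      rw [mul_one_div, div_le_div_iff₀ hN' two_pos]
      exact_mod_cast (by omega : Fintype.card ι * 2 ≤ 1 * N)
    have hnorm : 1 / 2 ≤ ‖x‖ := by linarith [norm_sub_norm_le s x]
    have hx0 : x ≠ 0 := norm_pos_iff.1 (by linarith)
    refine ⟨_, Finset.mem_image_of_mem _ (Finset.mem_filter.2 ⟨hx, hx0⟩), ‖x‖, hnorm, ?_⟩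
    simpa [smul_smul, hx0] using hnear

theorem le_signedAbsSum_of_near {κ : Type*} {I : Finset κ} {a : κ → ℝ} (ha : ∀ t, |a t| = 1)
    {U : κ → EuclideanSpace ℝ ι} {x s : EuclideanSpace ℝ ι} {ρ ε τ M : ℝ} (hρ : 1 / 2 ≤ ρ)
    (hε : 0 ≤ ε) (hτ : 0 ≤ τ) (hnear : ∀ j, |(s - ρ • x) j| ≤ ε)
    (hx : τ ≤ signedAbsSum I a U x) (hcoord : ∀ j, ∑ t ∈ I, |U t j| ≤ M) :
    τ / 2 - Fintype.card ι * ε * M ≤ signedAbsSum I a U s := by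
  have hscaled : τ / 2 ≤ signedAbsSum I a U (ρ • x) := by
    rw [signedAbsSum_smul, abs_of_nonneg (by linarith)]
    nlinarith
  have herror : ∑ t ∈ I, |inner ℝ (s - ρ • x) (U t)| ≤ Fintype.card ι * ε * M :=
    calc ∑ t ∈ I, |inner ℝ (s - ρ • x) (U t)|
        ≤ ∑ t ∈ I, ε * ∑ j, |U t j| :=
          Finset.sum_le_sum fun t _ => abs_inner_le_mul_sum_abs hnear _
      _ = ε * ∑ j, ∑ t ∈ I, |U t j| := by rw [← Finset.mul_sum, Finset.sum_comm]
      _ ≤ ε * ∑ _j : ι, M := by gcongr with j; exact hcoord j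
      _ = Fintype.card ι * ε * M := by simp; ring
  linarith [signedAbsSum_sub_le (I := I) ha U (ρ • x) s]

end Net

section Recovery

variable {n m r k T : ℕ} {A : Matrix (Fin n) (Fin n) ℝ} {B : Matrix (Fin n) (Fin m) ℝ}
  {C : Matrix (Fin r) (Fin n) ℝ} {D : Matrix (Fin r) (Fin m) ℝ}

theorem stateTraj_add (x0 : Fin n → ℝ) (u : ℕ → EuclideanSpace ℝ (Fin m)) (w : ℕ → Fin n → ℝ)
    (t N : ℕ) :
    stateTraj A B x0 u w (t + N) = A ^ N *ᵥ stateTraj A B x0 u w t +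
      ∑ j ∈ Finset.range N, A ^ j *ᵥ (B *ᵥ (u (t + N - 1 - j)).ofLp + w (t + N - 1 - j)) := by
  induction N with
  | zero => simp
  | succ N ih =>
    have hindex (j : ℕ) : t + (N + 1) - 1 - (j + 1) = t + N - 1 - j := by omega
    rw [← add_assoc, stateTraj, ih, add_assoc t N 1, Finset.sum_range_succ', Matrix.mulVec_add,
      Matrix.mulVec_mulVec, ← pow_succ', Matrix.mulVec_sum]
    simp only [hindex, Matrix.mulVec_mulVec, ← pow_succ']
    simp [add_assoc]

theorem markovMatrix_mulVec_stackedInput (hk : 1 ≤ k) (u : ℕ → EuclideanSpace ℝ (Fin m)) (t : ℕ) :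
    markovMatrix k A B C D *ᵥ (stackedInput k u t).ofLp = D *ᵥ (u t).ofLp +
      ∑ j ∈ Finset.range (2 * k - 1), (C * A ^ j * B) *ᵥ (u (t - 1 - j)).ofLp := by
  let block (j : ℕ) : Fin r → ℝ :=
    (if j = 0 then D else C * A ^ (j - 1) * B) *ᵥ (u (t - j)).ofLp
  have hblocks : markovMatrix k A B C D *ᵥ (stackedInput k u t).ofLp =
      ∑ j ∈ Finset.range (2 * k), block j := by
    ext i
    rw [Finset.sum_apply, ← Fin.sum_univ_eq_sum_range (fun j => block j i), Matrix.mulVec,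
      dotProduct, Fintype.sum_prod_type]
    refine Finset.sum_congr rfl fun j _ => Finset.sum_congr rfl fun c _ => ?_
    by_cases hj : j.1 = 0 <;> simp [markovMatrix, stackedInput, hj]
  rw [hblocks, show 2 * k = 2 * k - 1 + 1 by omega, Finset.sum_range_succ', add_comm]
  simp [block, Nat.sub_sub, add_comm]

theorem observation_eq_markovMatrix_mulVec_add (hk : 1 ≤ k) (hA : A ^ (2 * k - 1) = 0)
    (x0 : Fin n → ℝ) (u : ℕ → EuclideanSpace ℝ (Fin m)) (w : ℕ → Fin n → ℝ) {t : ℕ}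
    (ht : 2 * k - 1 ≤ t) :
    observation A B C D x0 u w t =
      markovMatrix k A B C D *ᵥ (stackedInput k u t).ofLp + attackTerm k A C w t := by
  obtain ⟨t₀, rfl⟩ := Nat.exists_eq_add_of_le' ht
  rw [observation, stateTraj_add, hA, Matrix.zero_mulVec, zero_add, Matrix.mulVec_sum,
    markovMatrix_mulVec_stackedInput hk, attackTerm]
  simp only [Matrix.mulVec_add, Finset.sum_add_distrib, Matrix.mulVec_mulVec, Matrix.mul_assoc]
  abel

theorem mulVec_ofLp_apply {ι : Type*} [Fintype ι] (G : Matrix (Fin r) ι ℝ) (x : EuclideanSpace ℝ ι)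
    (i : Fin r) : (G *ᵥ x.ofLp) i = inner ℝ (WithLp.toLp 2 (G i)) x := by
  simp [PiLp.inner_apply, Matrix.mulVec, dotProduct, mul_comm]

theorem signIndicator_mul_abs_le (a b : ℝ) : signIndicator (a = 0) * |b| ≤ |a - b| - |a| := by
  by_cases h : a = 0
  · simp [signIndicator, h]
  · have := abs_sub_abs_le_abs_sub a (a - b)
    simp only [signIndicator, h, if_false, sub_sub_cancel] at this ⊢
    linarith

theorem sum_signedAbsSum_le_l1Loss_sub {u : ℕ → EuclideanSpace ℝ (Fin m)} {y v : ℕ → Fin r → ℝ}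
    {G₀ : Matrix (Fin r) (Fin (2 * k) × Fin m) ℝ}
    (hy : ∀ t, 2 * k - 1 ≤ t → y t = G₀ *ᵥ (stackedInput k u t).ofLp + v t)
    (G : Matrix (Fin r) (Fin (2 * k) × Fin m) ℝ) :
    ∑ i, signedAbsSum (Finset.Icc (2 * k - 1) (T + 2 * k - 2))
        (fun t => signIndicator (v t i = 0)) (stackedInput k u) (WithLp.toLp 2 ((G - G₀) i)) ≤
      l1Loss k T u y G - l1Loss k T u y G₀ := by
  simp only [signedAbsSum, l1Loss]
  rw [Finset.sum_comm, ← Finset.sum_sub_distrib]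
  refine Finset.sum_le_sum fun t ht => ?_
  rw [← Finset.sum_sub_distrib, hy t (Finset.mem_Icc.1 ht).1]
  refine Finset.sum_le_sum fun i _ => (signIndicator_mul_abs_le _ _).trans_eq ?_
  rw [← mulVec_ofLp_apply, Matrix.sub_mulVec, Pi.sub_apply, Pi.add_apply, add_sub_cancel_left]
  congr 2
  ring

theorem l1Solutions_eq_singleton {u : ℕ → EuclideanSpace ℝ (Fin m)} {y v : ℕ → Fin r → ℝ}
    {G₀ : Matrix (Fin r) (Fin (2 * k) × Fin m) ℝ}
    (hy : ∀ t, 2 * k - 1 ≤ t → y t = G₀ *ᵥ (stackedInput k u t).ofLp + v t)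
    (hpos : ∀ i s, ‖s‖ = 1 → 0 < signedAbsSum (Finset.Icc (2 * k - 1) (T + 2 * k - 2))
      (fun t => signIndicator (v t i = 0)) (stackedInput k u) s) :
    l1Solutions k T u y = {G₀} := by
  have hnonneg (G : Matrix (Fin r) (Fin (2 * k) × Fin m) ℝ) (i : Fin r) :=
    signedAbsSum_nonneg (hpos i) (WithLp.toLp 2 ((G - G₀) i))
  refine Set.eq_singleton_iff_unique_mem.2 ⟨fun G => ?_, fun G hG => ?_⟩
  · exact sub_nonneg.1 ((Finset.sum_nonneg fun i _ => hnonneg G i).trans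
      (sum_signedAbsSum_le_l1Loss_sub hy G))
  · by_contra hne
    obtain ⟨i, hi⟩ := Function.ne_iff.1 (sub_ne_zero.2 hne)
    have hrow := signedAbsSum_pos (hpos i) (s := WithLp.toLp 2 ((G - G₀) i)) fun h =>
      hi (congrArg WithLp.ofLp h)
    have hsum := Finset.sum_pos' (fun i _ => hnonneg G i) ⟨i, Finset.mem_univ i, hrow⟩
    linarith [sum_signedAbsSum_le_l1Loss_sub (T := T) hy G, hG G₀]

theorem sum_Icc_window {M : Type*} [AddCommMonoid M] (hk : 1 ≤ k) (f : ℕ → M) :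
    ∑ t ∈ Finset.Icc (2 * k - 1) (T + 2 * k - 2), f t =
      ∑ i ∈ Finset.range T, f (2 * k - 1 + i) := by
  rw [← Finset.Ico_add_one_right_eq_Icc, Finset.sum_Ico_eq_sum_range]
  congr 2
  omega

end Recovery

section FixedDirection

variable {Ω : Type*} [MeasurableSpace Ω] {μ : Measure Ω} {m k : ℕ} {γ : ℝ} {ξ : ℕ → Ω → ℕ}
  {u : ℕ → Ω → EuclideanSpace ℝ (Fin m)} {s : EuclideanSpace ℝ (Fin (2 * k) × Fin m)}

/-- The contribution of the `i`-th window to `signedAbsSum`, normalized by `γ` and recentred at `c`,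
as a function of the joint sequence of inputs and attack times. -/
noncomputable def centredWindow (a : (ℕ → ℕ) → ℝ) (s : EuclideanSpace ℝ (Fin (2 * k) × Fin m))
    (γ c : ℝ) (i : ℕ) (z : ℕ → EuclideanSpace ℝ (Fin m) × ℕ) : ℝ :=
  a (fun t => (z t).2) * |inner ℝ s (stackedInput k (fun t => (z t).1) (2 * k - 1 + i)) / γ| - c

theorem measurable_centredWindow {a : (ℕ → ℕ) → ℝ} (ma : Measurable a)
    (s : EuclideanSpace ℝ (Fin (2 * k) × Fin m)) (γ c : ℝ) (i : ℕ) :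
    Measurable (centredWindow a s γ c i) := by
  have hsignal := (measurable_inner_stackedInput s (2 * k - 1 + i)).comp
    (measurable_pi_lambda (fun (z : ℕ → EuclideanSpace ℝ (Fin m) × ℕ) t => (z t).1)
      fun t => by fun_prop)
  have hattack := ma.comp
    (measurable_pi_lambda (fun (z : ℕ → EuclideanSpace ℝ (Fin m) × ℕ) t => (z t).2)
      fun t => by fun_prop)
  exact (hattack.mul (hsignal.div_const γ).abs).sub_const c

theorem dependsOn_centredWindow {a : (ℕ → ℕ) → ℝ} {i : ℕ}
    (ha : DependsOn a (Set.Ico i (i + 2 * k))) (s : EuclideanSpace ℝ (Fin (2 * k) × Fin m))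
    (γ c : ℝ) : DependsOn (centredWindow a s γ c i) (Set.Ico i (i + 2 * k)) := by
  intro z z' h
  have hsignal : inner ℝ s (stackedInput k (fun t => (z t).1) (2 * k - 1 + i)) =
      inner ℝ s (stackedInput k (fun t => (z' t).1) (2 * k - 1 + i)) :=
    dependsOn_inner_stackedInput s i fun t ht => congrArg Prod.fst (h t ht)
  have hattack : a (fun t => (z t).2) = a fun t => (z' t).2 :=
    ha fun t ht => congrArg Prod.snd (h t ht)
  rw [centredWindow, centredWindow, hsignal, hattack]

theorem signedAbsSum_lt_iff_sum_centredWindow_neg (hγ : 0 < γ) (a : ℕ → (ℕ → ℕ) → ℝ) (c : ℝ)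
    (T : ℕ) (v : ℕ → EuclideanSpace ℝ (Fin m)) (x : ℕ → ℕ) :
    signedAbsSum (Finset.range T) (fun i => a i x) (fun i => stackedInput k v (2 * k - 1 + i)) s <
        c * (γ * T) ↔
      ∑ i ∈ Finset.range T, centredWindow (a i) s γ c i (fun t => (v t, x t)) < 0 := by
  simp only [centredWindow, signedAbsSum, Finset.sum_sub_distrib, abs_div, abs_of_pos hγ,
    ← mul_div_assoc, ← Finset.sum_div, Finset.sum_const, Finset.card_range, nsmul_eq_mul]
  rw [sub_neg, div_lt_iff₀ hγ]
  ring_nf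

theorem measureReal_signedAbsSum_lt_le (mξ : ∀ t, Measurable (ξ t)) (iξ : iIndepFun ξ μ)
    (hinput : IsGaussianInput μ γ u) (hindep : IndepFun (fun ω t => u t ω) (fun ω t => ξ t ω) μ)
    (hk : 1 ≤ k) (hγ : 0 < γ) (hs : ‖s‖ = 1) {a : ℕ → (ℕ → ℕ) → ℝ} (ma : ∀ i, Measurable (a i))
    (ha : ∀ i, DependsOn (a i) (Set.Ico i (i + 2 * k))) (hsign : ∀ i x, a i x = 1 ∨ a i x = -1)
    {c θ ρ : ℝ} (hθ : 0 ≤ θ) (hρ : ρ ≤ 1)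
    (hmgf : ∀ i, mgf (fun ω => a i (fun t => ξ t ω) *
      |inner ℝ s (stackedInput k (fun t => u t ω) (2 * k - 1 + i)) / γ| - c) μ (-θ) ≤ ρ) (T : ℕ) :
    μ.real {ω | signedAbsSum (Finset.range T) (fun i => a i fun t => ξ t ω)
      (fun i => stackedInput k (fun t => u t ω) (2 * k - 1 + i)) s < c * (γ * T)} ≤
      (2 * k : ℕ) * ρ ^ (T / (2 * k)) := by
  simp only [signedAbsSum_lt_iff_sum_centredWindow_neg hγ]
  refine measureReal_sum_window_neg_le (fun t => (hinput.measurable t).prodMk (mξ t))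
    (iIndepFun_prodMk_of_indepFun hinput.measurable mξ hinput.iIndep iξ hindep) (by omega)
    (fun i => measurable_centredWindow (ma i) s γ c i)
    (fun i => dependsOn_centredWindow (ha i) s γ c) hθ hρ (fun i => ?_) hmgf T
  exact integrable_exp_sign_mul_abs_sub
    (hasLaw_inner_stackedInput hinput hγ.ne' (Nat.le_add_right _ i) hs)
    ((ma i).comp (measurable_pi_lambda _ mξ)) (fun ω => hsign i _) θ c

theorem measureReal_signedAbsSum_windowSign_lt_le (mξ : ∀ t, Measurable (ξ t))
    (iξ : iIndepFun ξ μ) (hinput : IsGaussianInput μ γ u)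
    (hindep : IndepFun (fun ω t => u t ω) (fun ω t => ξ t ω) μ) (hk : 1 ≤ k) (hγ : 0 < γ)
    (hs : ‖s‖ = 1) {β : ℝ} (hβ0 : 0 ≤ β) (hβ1 : β ≤ 1)
    (hβ : ∀ i, β ≤ ∫ ω, windowSign k (fun t => ξ t ω) i ∂μ) (T : ℕ) :
    μ.real {ω | signedAbsSum (Finset.range T) (windowSign k fun t => ξ t ω)
      (fun i => stackedInput k (fun t => u t ω) (2 * k - 1 + i)) s < β / 6 * (γ * T)} ≤
      (2 * k : ℕ) * Real.exp (-(β ^ 2 / 144)) ^ (T / (2 * k)) := by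
  refine measureReal_signedAbsSum_lt_le mξ iξ hinput hindep hk hγ hs
    (a := fun i x => windowSign k x i) (measurable_windowSign k) (dependsOn_windowSign k)
    (fun i x => windowSign_eq_or k x i) (θ := β / 12) (by positivity)
    (Real.exp_le_one_iff.2 (neg_nonpos.2 (by positivity))) (fun i => ?_) T
  exact mgf_sign_mul_abs_sub_le
    (hasLaw_inner_stackedInput hinput hγ.ne' (Nat.le_add_right _ i) hs)
    ((measurable_windowSign k i).comp (measurable_pi_lambda _ mξ))
    (fun ω => windowSign_eq_or k _ i)
    (hindep.symm.comp (measurable_windowSign k i)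
      ((measurable_inner_stackedInput s (2 * k - 1 + i)).div_const γ)) hβ0 hβ1 (hβ i)

theorem measureReal_lt_sum_abs_inner_le (mξ : ∀ t, Measurable (ξ t)) (iξ : iIndepFun ξ μ)
    (hinput : IsGaussianInput μ γ u) (hindep : IndepFun (fun ω t => u t ω) (fun ω t => ξ t ω) μ)
    (hk : 1 ≤ k) (hγ : 0 < γ) (hs : ‖s‖ = 1) (T : ℕ) :
    μ.real {ω | 3 * (γ * T) < ∑ i ∈ Finset.range T,
      |inner ℝ s (stackedInput k (fun t => u t ω) (2 * k - 1 + i))|} ≤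
      (2 * k : ℕ) * Real.exp (-1) ^ (T / (2 * k)) := by
  have := hinput.iIndep.isProbabilityMeasure
  have h := measureReal_signedAbsSum_lt_le mξ iξ hinput hindep hk hγ hs (a := fun _ _ => -1)
    (fun _ => measurable_const) (fun _ _ _ _ => rfl) (fun _ _ => .inr rfl) zero_le_one
    (Real.exp_le_one_iff.2 (by norm_num)) (fun i => mgf_neg_abs_sub_le
      (hasLaw_inner_stackedInput hinput hγ.ne' (Nat.le_add_right _ i) hs)) T
  simpa only [signedAbsSum, neg_mul, one_mul, Finset.sum_neg_distrib, neg_lt_neg_iff] using h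

end FixedDirection

section Constants

theorem le_two_mul_max_one_mul_log_div_add {x β c : ℝ} (hβ0 : 0 < β) (hβ1 : β ≤ 1)
    (hc : 0 ≤ c) : x ≤ 2 * max 1 (x * Real.log (x / β) + c) := by
  rcases le_total x 2 with hx2 | hx2
  · exact hx2.trans (le_mul_of_one_le_right two_pos.le (le_max_left _ _))
  · have hlog : 1 / 2 ≤ Real.log (x / β) :=
      calc (1 / 2 : ℝ) ≤ Real.log 2 := by linarith [Real.log_two_gt_d9]
        _ ≤ Real.log (x / β) := Real.log_le_log two_pos
          (hx2.trans (le_div_self (by linarith) hβ0 hβ1))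
    calc x ≤ 2 * (x * Real.log (x / β) + c) := by nlinarith
      _ ≤ 2 * max 1 (x * Real.log (x / β) + c) := by gcongr; exact le_max_right _ _

theorem le_two_mul_mul_div {L T : ℕ} (hL : 0 < L) (hLT : L ≤ T) : T ≤ 2 * L * (T / L) := by
  have hquot : 1 ≤ T / L := (Nat.one_le_div_iff hL).2 hLT
  have hmod := Nat.mod_lt T hL
  have hdiv := Nat.div_add_mod T L
  nlinarith

theorem exp_neg_sq_pow_div_le {k T : ℕ} {β M : ℝ} (hk : 1 ≤ k) (hβ0 : 0 < β) (hβ1 : β ≤ 1)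
    (hM : 1 ≤ M) (hT : 23040 * ((k : ℝ) / β ^ 2 * M) ≤ T) :
    Real.exp (-(β ^ 2 / 144)) ^ (T / (2 * k)) ≤ Real.exp (-(40 * M)) := by
  have hk' : (0 : ℝ) < k := by exact_mod_cast hk
  have hwindow : 2 * k ≤ T := by
    have hkβM : (k : ℝ) ≤ k / β ^ 2 * M :=
      (le_div_self hk'.le (by positivity) (pow_le_one₀ hβ0.le hβ1)).trans
        (le_mul_of_one_le_right (by positivity) hM)
    have : ((2 * k : ℕ) : ℝ) ≤ T := by push_cast; linarith
    exact_mod_cast this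
  have hquot : (T : ℝ) ≤ 4 * k * (T / (2 * k) : ℕ) := by
    have := le_two_mul_mul_div (by omega) hwindow
    rw [← mul_assoc] at this
    exact_mod_cast this
  have hblocks : 5760 * M ≤ (T / (2 * k) : ℕ) * β ^ 2 := by
    refine le_of_mul_le_mul_left ?_ (by positivity : 0 < 4 * (k : ℝ))
    calc 4 * (k : ℝ) * (5760 * M) = 23040 * ((k : ℝ) / β ^ 2 * M) * β ^ 2 := by field_simp; ring
      _ ≤ 4 * k * (T / (2 * k) : ℕ) * β ^ 2 :=
        mul_le_mul_of_nonneg_right (hT.trans hquot) (sq_nonneg β)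
      _ = 4 * k * ((T / (2 * k) : ℕ) * β ^ 2) := mul_assoc _ _ _
  rw [← Real.exp_nat_mul, Real.exp_le_exp]
  linarith

theorem two_mul_ceil_add_one_le_exp {y : ℝ} (hy : 1 ≤ y) :
    2 * (⌈144 * y⌉₊ : ℝ) + 1 ≤ Real.exp (6 + Real.log y) := by
  have hexp : (294 : ℝ) ≤ Real.exp 6 :=
    calc (294 : ℝ) ≤ 2.7 ^ 6 := by norm_num
      _ ≤ Real.exp 1 ^ 6 := by gcongr; linarith [Real.exp_one_gt_d9]
      _ = Real.exp 6 := by rw [← Real.exp_nat_mul]; norm_num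
  have hceil := Nat.ceil_lt_add_one (by linarith : 0 ≤ 144 * y)
  rw [Real.exp_add, Real.exp_log (by linarith)]
  nlinarith

theorem netCard_pow_le_exp {d : ℕ} {y M : ℝ} (hy : 1 ≤ y) (hd : (d : ℝ) ≤ 4 * M)
    (hlog : d * Real.log y ≤ 2 * M) :
    (2 * (⌈144 * y⌉₊ : ℝ) + 1) ^ d ≤ Real.exp (26 * M) :=
  calc (2 * (⌈144 * y⌉₊ : ℝ) + 1) ^ d
      ≤ Real.exp (6 + Real.log y) ^ d := by gcongr; exact two_mul_ceil_add_one_le_exp hy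
    _ = Real.exp (d * (6 + Real.log y)) := (Real.exp_nat_mul _ _).symm
    _ ≤ Real.exp (26 * M) := Real.exp_le_exp.2 (by linarith)

theorem exp_union_bound {P Q k E M : ℝ} (hP : P ≤ Real.exp (26 * M)) (hQ : Q ≤ Real.exp (26 * M))
    (hk0 : 0 ≤ k) (hk : k ≤ 2 * M) (hE0 : 0 ≤ E) (hE : E ≤ Real.exp (-(40 * M))) :
    (P + Q) * (2 * k * E) ≤ Real.exp (-(6 * M)) :=
  calc (P + Q) * (2 * k * E)
      ≤ (Real.exp (26 * M) + Real.exp (26 * M)) * (2 * k * Real.exp (-(40 * M))) := by gcongr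
    _ = Real.exp (26 * M) * (4 * k) * Real.exp (-(40 * M)) := by ring
    _ ≤ Real.exp (26 * M) * Real.exp (8 * M) * Real.exp (-(40 * M)) := by
        gcongr
        linarith [Real.add_one_le_exp (8 * M)]
    _ = Real.exp (-(6 * M)) := by rw [← Real.exp_add, ← Real.exp_add]; ring_nf

theorem union_bound_le {k m T : ℕ} (hk : 1 ≤ k) (hm : 1 ≤ m) {β δ : ℝ} (hβ0 : 0 < β)
    (hβ1 : β ≤ 1) (hδ0 : 0 < δ) (hδ1 : δ ≤ 1)
    (hT : 23040 * ((k : ℝ) / β ^ 2 * max 1 ((k : ℝ) * m * Real.log ((k : ℝ) * m / β)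
      + Real.log (1 / δ))) ≤ T) :
    ((2 * (⌈144 * ((k : ℝ) * m / β)⌉₊ : ℝ) + 1) ^ (2 * k * m) + (2 * k * m : ℕ)) *
      ((2 * k : ℕ) * Real.exp (-(β ^ 2 / 144)) ^ (T / (2 * k))) ≤ δ := by
  have hk1 : (1 : ℝ) ≤ k := by exact_mod_cast hk
  have hm1 : (1 : ℝ) ≤ m := by exact_mod_cast hm
  have hkm1 : (1 : ℝ) ≤ k * m := one_le_mul_of_one_le_of_one_le hk1 hm1
  have hy1 : 1 ≤ (k : ℝ) * m / β := hkm1.trans (le_div_self (by linarith) hβ0 hβ1)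
  have hδlog : 0 ≤ Real.log (1 / δ) := Real.log_nonneg ((one_le_div hδ0).2 hδ1)
  have hklog : 0 ≤ (k : ℝ) * m * Real.log ((k : ℝ) * m / β) :=
    mul_nonneg (by linarith) (Real.log_nonneg hy1)
  have hkm := le_two_mul_max_one_mul_log_div_add (x := (k : ℝ) * m) hβ0 hβ1 hδlog
  set M := max 1 ((k : ℝ) * m * Real.log ((k : ℝ) * m / β) + Real.log (1 / δ))
  have hM1 : 1 ≤ M := le_max_left _ _
  have hM : (k : ℝ) * m * Real.log ((k : ℝ) * m / β) + Real.log (1 / δ) ≤ M := le_max_right _ _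
  have hd : ((2 * k * m : ℕ) : ℝ) = 2 * (k * m) := by push_cast; ring
  calc ((2 * (⌈144 * ((k : ℝ) * m / β)⌉₊ : ℝ) + 1) ^ (2 * k * m) + (2 * k * m : ℕ)) *
        ((2 * k : ℕ) * Real.exp (-(β ^ 2 / 144)) ^ (T / (2 * k)))
      ≤ Real.exp (-(6 * M)) := by
        rw [Nat.cast_mul 2 k, Nat.cast_two]
        refine exp_union_bound (netCard_pow_le_exp hy1 ?_ ?_) ?_ (by linarith)
          (by nlinarith) (by positivity) (exp_neg_sq_pow_div_le hk hβ0 hβ1 hM1 hT)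
        · linarith
        · rw [hd]; linarith
        · linarith [Real.add_one_le_exp (26 * M)]
    _ ≤ Real.exp (-Real.log (1 / δ)) := Real.exp_le_exp.2 (by linarith)
    _ = δ := by rw [Real.exp_neg, Real.exp_log (by positivity), one_div, inv_inv]

end Constants

section Uniform

variable {Ω : Type*} [MeasurableSpace Ω] {μ : Measure Ω}

theorem one_sub_le_measureReal_of_compl_subset [IsProbabilityMeasure μ] {s t : Set Ω}
    (h : sᶜ ⊆ t) : 1 - μ.real t ≤ μ.real s := by
  have hunion : μ.real Set.univ ≤ μ.real (s ∪ t) :=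
    measureReal_mono fun ω _ => or_iff_not_imp_left.2 fun hω => h hω
  rw [probReal_univ] at hunion
  linarith [measureReal_union_le (μ := μ) s t]

theorem one_sub_le_measureReal_forall_le_signedAbsSum [IsProbabilityMeasure μ] {ι κ : Type*}
    [Fintype ι] {N : ℕ} (hN : 0 < N) (hdN : 2 * Fintype.card ι ≤ N) {I : Finset κ}
    {a : Ω → κ → ℝ} (ha : ∀ ω t, |a ω t| = 1) {U : Ω → κ → EuclideanSpace ℝ ι} {τ M η : ℝ}
    (hτ : 0 ≤ τ) (hη : 0 ≤ η)
    (hlower : ∀ s, ‖s‖ = 1 → μ.real {ω | signedAbsSum I (a ω) (U ω) s < τ} ≤ η)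
    (hupper : ∀ s, ‖s‖ = 1 → μ.real {ω | M < ∑ t ∈ I, |inner ℝ s (U ω t)|} ≤ η) :
    1 - ((2 * (N : ℝ) + 1) ^ Fintype.card ι + Fintype.card ι) * η ≤
      μ.real {ω | ∀ s, ‖s‖ = 1 →
        τ / 2 - Fintype.card ι * (1 / N) * M ≤ signedAbsSum I (a ω) (U ω) s} := by
  classical
  obtain ⟨S, hunit, hcard, hnet⟩ := exists_unit_net (ι := ι) hN hdN
  let e (j : ι) : EuclideanSpace ℝ ι := EuclideanSpace.single j 1
  let low := ⋃ x ∈ S, {ω | signedAbsSum I (a ω) (U ω) x < τ}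
  let high := ⋃ j ∈ Finset.univ, {ω | M < ∑ t ∈ I, |inner ℝ (e j) (U ω t)|}
  have hlow : μ.real low ≤ (2 * (N : ℝ) + 1) ^ Fintype.card ι * η := by
    refine (measureReal_biUnion_finset_le _ _).trans ((Finset.sum_le_sum fun x hx =>
      hlower x (hunit x hx)).trans ?_)
    rw [Finset.sum_const, nsmul_eq_mul]
    exact mul_le_mul_of_nonneg_right (by exact_mod_cast hcard) hη
  have hhigh : μ.real high ≤ Fintype.card ι * η := by
    refine (measureReal_biUnion_finset_le _ _).trans ((Finset.sum_le_sum fun j _ =>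
      hupper (e j) (by simp [e])).trans_eq ?_)
    rw [Finset.sum_const, Finset.card_univ, nsmul_eq_mul]
  refine le_trans ?_ (one_sub_le_measureReal_of_compl_subset (t := low ∪ high) ?_)
  · linarith [measureReal_union_le (μ := μ) low high]
  · rw [Set.compl_subset_comm]
    intro ω hω s hs
    simp only [low, high, e, Set.compl_union, Set.compl_iUnion, Set.mem_inter_iff, Set.mem_iInter,
      Set.mem_compl_iff, Set.mem_ofPred_eq, not_lt, Finset.mem_univ, true_imp_iff,
      EuclideanSpace.inner_single_left, map_one, one_mul] at hω
    obtain ⟨x, hx, ρ, hρ, hnear⟩ := hnet s hs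
    exact le_signedAbsSum_of_near (ha ω) hρ (by positivity) hτ hnear (hω.1 x hx) hω.2

variable {m k : ℕ} {γ : ℝ} {ξ : ℕ → Ω → ℕ} {u : ℕ → Ω → EuclideanSpace ℝ (Fin m)}

theorem one_sub_le_measureReal_forall_le_signedAbsSum_windowSign (mξ : ∀ t, Measurable (ξ t))
    (iξ : iIndepFun ξ μ) (hinput : IsGaussianInput μ γ u)
    (hindep : IndepFun (fun ω t => u t ω) (fun ω t => ξ t ω) μ) (hk : 1 ≤ k) (hm : 1 ≤ m)
    (hγ : 0 < γ) {β : ℝ} (hβ0 : 0 < β) (hβ1 : β ≤ 1)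
    (hβ : ∀ i, β ≤ ∫ ω, windowSign k (fun t => ξ t ω) i ∂μ) {δ : ℝ} (hδ0 : 0 < δ) (hδ1 : δ ≤ 1)
    {T : ℕ} (hT : 23040 * ((k : ℝ) / β ^ 2 *
      max 1 ((k : ℝ) * m * Real.log ((k : ℝ) * m / β) + Real.log (1 / δ))) ≤ T) :
    1 - δ ≤ μ.real {ω | ∀ s, ‖s‖ = 1 → 1 / 24 * (γ * β * T) ≤
      signedAbsSum (Finset.range T) (windowSign k fun t => ξ t ω)
        (fun i => stackedInput k (fun t => u t ω) (2 * k - 1 + i)) s} := by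
  have := iξ.isProbabilityMeasure
  have hkm : (0 : ℝ) < (k : ℝ) * m := by exact_mod_cast Nat.mul_pos hk hm
  set N := ⌈144 * ((k : ℝ) * m / β)⌉₊
  have hceil : 144 * ((k : ℝ) * m / β) ≤ N := Nat.le_ceil _
  have hkmN : 144 * ((k : ℝ) * m) ≤ β * N := by
    rw [← mul_div_assoc, div_le_iff₀ hβ0] at hceil
    linarith
  have hN : 0 < N := Nat.ceil_pos.2 (by positivity)
  have hcard : Fintype.card (Fin (2 * k) × Fin m) = 2 * k * m := by simp
  have hdN : 2 * Fintype.card (Fin (2 * k) × Fin m) ≤ N := by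
    have := le_div_self hkm.le hβ0 hβ1
    have : 2 * ((2 * k * m : ℕ) : ℝ) ≤ N := by push_cast; nlinarith
    rw [hcard]
    exact_mod_cast this
  have huniform := one_sub_le_measureReal_forall_le_signedAbsSum hN hdN
    (I := Finset.range T) (fun ω i => abs_windowSign k (fun t => ξ t ω) i)
    (U := fun ω i => stackedInput k (fun t => u t ω) (2 * k - 1 + i))
    (by positivity : 0 ≤ β / 6 * (γ * T)) (by positivity)
    (fun s hs => measureReal_signedAbsSum_windowSign_lt_le mξ iξ hinput hindep hk hγ hs hβ0.le
      hβ1 hβ T)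
    (fun s hs => (measureReal_lt_sum_abs_inner_le mξ iξ hinput hindep hk hγ hs T).trans (by
      gcongr; nlinarith))
  rw [hcard] at huniform
  refine (sub_le_sub_left (union_bound_le hk hm hβ0 hβ1 hδ0 hδ1 hT) 1).trans
    (huniform.trans (measureReal_mono fun ω hω s hs => le_trans ?_ (hω s hs)))
  have hmesh : ((2 * k * m : ℕ) : ℝ) * (1 / N) ≤ β / 72 := by
    rw [mul_one_div, div_le_iff₀ (by positivity)]
    push_cast
    linarith
  have := mul_le_mul_of_nonneg_right hmesh (by positivity : 0 ≤ 3 * (γ * (T : ℝ)))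
  linarith

end Uniform

section Estimation

variable {n m r k T : ℕ}

theorem signedAbsSum_windowSign_le (hk : 1 ≤ k) (A : Matrix (Fin n) (Fin n) ℝ)
    (C : Matrix (Fin r) (Fin n) ℝ) {w : ℕ → Fin n → ℝ} {x : ℕ → ℕ} (hw : ∀ t, x t = 0 → w t = 0)
    (v : ℕ → EuclideanSpace ℝ (Fin m)) (s : EuclideanSpace ℝ (Fin (2 * k) × Fin m)) (e : Fin r) :
    signedAbsSum (Finset.range T) (windowSign k x) (fun i => stackedInput k v (2 * k - 1 + i)) s ≤
      signedAbsSum (Finset.Icc (2 * k - 1) (T + 2 * k - 2))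
        (fun t => signIndicator (attackTerm k A C w t e = 0)) (stackedInput k v) s := by
  refine (signedAbsSum_mono (fun i => windowSign_le_signIndicator A C hw i e) _ s).trans_eq ?_
  rw [signedAbsSum, signedAbsSum, sum_Icc_window hk]

theorem one_sub_pow_lt_half {k : ℕ} (hk : 1 ≤ k) {p : ℝ} (hp : p < 1 / (4 * (k : ℝ) - 2)) :
    1 - (1 - p) ^ (2 * k - 1) < 1 / 2 := by
  have hk' : (1 : ℝ) ≤ k := by exact_mod_cast hk
  rw [lt_div_iff₀ (by linarith)] at hp
  have hbernoulli := one_add_mul_le_pow (by nlinarith : -2 ≤ -p) (2 * k - 1)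
  rw [Nat.cast_sub (by omega)] at hbernoulli
  push_cast at hbernoulli
  rw [← sub_eq_add_neg] at hbernoulli
  linarith

theorem mul_max_log_one_div_le {K x a r δ : ℝ} (hK : 0 ≤ K) (hx : 0 ≤ x) (hδ : 0 < δ)
    (hr : 1 ≤ r) : K * (x * max 1 (a + Real.log (1 / δ))) ≤
      K * (x * max 1 (a + Real.log (r / δ))) := by
  gcongr

theorem measureReal_preimage_zero_of_isProbabilisticAttack {Ω : Type*} [MeasurableSpace Ω]
    {μ : Measure Ω} {p : unitInterval} {x0 : Ω → Fin n → ℝ} {w : ℕ → Ω → Fin n → ℝ}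
    {ξ : ℕ → Ω → ℕ} (h : IsProbabilisticAttack μ p x0 w ξ) (t : ℕ) :
    μ.real (ξ t ⁻¹' {0}) = 1 - (p : ℝ) := by
  rw [← map_measureReal_apply (h.measurable_time t) (measurableSet_singleton 0),
    (h.hasLaw t).map_eq, bernoulliMeasure_real_apply_of_notMem_of_mem p
      (measurableSet_singleton 0) (by simp) (by simp)]

end Estimation

/- One event serves every system at once, because `windowSign` and the inputs involve neither the
matrices nor the attack vectors. -/
theorem theorem2_general :
    ∃ K > (0 : ℝ), ∃ c > (0 : ℝ),
      ∀ (m k T : ℕ) (_ : 1 ≤ m) (_ : 1 ≤ k) (p : unitInterval)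
        (q : ℝ) (_ : q = 1 - (1 - (p : ℝ)) ^ (2 * k - 1)) (_ : q < 1 / 2)
        (γ : ℝ) (_ : 0 < γ) (δ : ℝ) (_ : δ ∈ Set.Ioc (0 : ℝ) 1)
        (Ω : Type*) [MeasurableSpace Ω] (μ : Measure Ω) (ξ : ℕ → Ω → ℕ)
        (u : ℕ → Ω → EuclideanSpace ℝ (Fin m))
        (_ : ∀ t, Measurable (ξ t)) (_ : ∀ t, 1 - (p : ℝ) ≤ μ.real (ξ t ⁻¹' {0}))
        (_ : iIndepFun ξ μ) (_ : IsGaussianInput μ γ u)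
        (_ : IndepFun (fun ω t => u t ω) (fun ω t => ξ t ω) μ)
        (_ : K * ((k : ℝ) / (1 - 2 * q) ^ 2 *
            max 1 ((k : ℝ) * m * Real.log ((k : ℝ) * m / (1 - 2 * q))
              + Real.log (1 / δ))) ≤ (T : ℝ)),
        0 < c * (γ * (1 - 2 * q) * T) ∧
        1 - δ ≤ μ.real {ω |
          ∀ (n r : ℕ) (A : Matrix (Fin n) (Fin n) ℝ) (B : Matrix (Fin n) (Fin m) ℝ)
            (C : Matrix (Fin r) (Fin n) ℝ) (D : Matrix (Fin r) (Fin m) ℝ) (x0 : Fin n → ℝ)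
            (w : ℕ → Fin n → ℝ), (∀ t, ξ t ω = 0 → w t = 0) →
          (∀ s : EuclideanSpace ℝ (Fin (2 * k) × Fin m), ‖s‖ = 1 → ∀ i : Fin r,
            c * (γ * (1 - 2 * q) * T) ≤
              ∑ t ∈ Finset.Icc (2 * k - 1) (T + 2 * k - 2),
                signIndicator (attackTerm k A C w t i = 0) *
                  |inner ℝ s (stackedInput k (fun j => u j ω) t)|) ∧
          (A ^ (2 * k - 1) = 0 →
            l1Solutions k T (fun j => u j ω) (observation A B C D x0 (fun j => u j ω) w) =
              {markovMatrix k A B C D})} := by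
  refine ⟨23040, by norm_num, 1 / 24, by norm_num, ?_⟩
  intro m k T hm hk p q hq hq2 γ hγ δ hδ Ω _ μ ξ u mξ hξ iξ hinput hindep hT
  have := iξ.isProbabilityMeasure
  have hβ0 : 0 < 1 - 2 * q := by linarith
  have hβ1 : 1 - 2 * q ≤ 1 := by
    linarith [pow_le_one₀ (n := 2 * k - 1) (sub_nonneg.2 p.2.2) (sub_le_self 1 p.2.1)]
  have hT0 : (0 : ℝ) < T := hT.trans_lt' (mul_pos (by norm_num)
    (mul_pos (div_pos (by exact_mod_cast hk) (pow_pos hβ0 2)) (lt_max_of_lt_left one_pos)))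
  have hβ (i : ℕ) : 1 - 2 * q ≤ ∫ ω, windowSign k (fun t => ξ t ω) i ∂μ := by
    refine (le_integral_windowSign mξ iξ p.2.2 hξ k i).trans' ?_
    linarith
  have hlower : 0 < 1 / 24 * (γ * (1 - 2 * q) * T) := by positivity
  refine ⟨hlower, (one_sub_le_measureReal_forall_le_signedAbsSum_windowSign mξ iξ hinput hindep
    hk hm hγ hβ0 hβ1 hβ hδ.1 hδ.2 hT).trans (measureReal_mono ?_)⟩
  intro ω hω n r A B C D x0 w hw
  have hbound (s : EuclideanSpace ℝ (Fin (2 * k) × Fin m)) (hs : ‖s‖ = 1) (i : Fin r) :=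
    (hω s hs).trans (signedAbsSum_windowSign_le hk A C hw _ s i)
  refine ⟨hbound, fun hA => l1Solutions_eq_singleton
    (fun t ht => observation_eq_markovMatrix_mulVec_add hk hA x0 _ w ht)
    fun i s hs => hlower.trans_le (hbound s hs i)⟩

theorem theorem2 :
    ∃ K > (0 : ℝ), ∃ c > (0 : ℝ),
      ∀ (n m r k T : ℕ) (_hm : 1 ≤ m) (_hr : 1 ≤ r) (_hk : 1 ≤ k)
        (A : Matrix (Fin n) (Fin n) ℝ) (B : Matrix (Fin n) (Fin m) ℝ)
        (C : Matrix (Fin r) (Fin n) ℝ) (D : Matrix (Fin r) (Fin m) ℝ)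
        (p : unitInterval) (_hp : (p : ℝ) < 1 / (4 * (k : ℝ) - 2))
        (q : ℝ) (_hq : q = 1 - (1 - (p : ℝ)) ^ (2 * k - 1))
        (γ : ℝ) (_hγ : 0 < γ) (δ : ℝ) (_hδ : δ ∈ Set.Ioc (0 : ℝ) 1)
        (Ω : Type*) [MeasurableSpace Ω] (μ : Measure Ω) [IsProbabilityMeasure μ]
        (x0 : Ω → Fin n → ℝ) (w : ℕ → Ω → Fin n → ℝ) (ξ : ℕ → Ω → ℕ)
        (u : ℕ → Ω → EuclideanSpace ℝ (Fin m))
        (_hattack : IsProbabilisticAttack μ p x0 w ξ)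
        (_hinput : IsGaussianInput μ γ u)
        (_hindep : IndepFun (fun ω t => u t ω) (fun ω t => ξ t ω) μ)
        (_hT : K * ((k : ℝ) / (1 - 2 * q) ^ 2 *
            max 1 ((k : ℝ) * m * Real.log ((k : ℝ) * m / (1 - 2 * q))
              + Real.log ((r : ℝ) / δ))) ≤ (T : ℝ)),
        0 < c * (γ * (1 - 2 * q) * T) ∧
        1 - δ ≤ μ.real {ω |
          (∀ s : EuclideanSpace ℝ (Fin (2 * k) × Fin m), ‖s‖ = 1 → ∀ i : Fin r,
            c * (γ * (1 - 2 * q) * T) ≤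
              ∑ t ∈ Finset.Icc (2 * k - 1) (T + 2 * k - 2),
                signIndicator (attackTerm k A C (fun j => w j ω) t i = 0) *
                  |inner ℝ s (stackedInput k (fun j => u j ω) t)|) ∧
          (A ^ (2 * k - 1) = 0 →
            l1Solutions k T (fun j => u j ω)
                (observation A B C D (x0 ω) (fun j => u j ω) (fun j => w j ω)) =
              {markovMatrix k A B C D})} := by
  obtain ⟨K, hK, c, hc, h⟩ := theorem2_general
  refine ⟨K, hK, c, hc, ?_⟩
  intro n m r k T hm hr hk A B C D p hp q hq γ hγ δ hδ Ω _ μ _ x0 w ξ u hattack hinput hindep hT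
  exact (h m k T hm hk p q hq (hq ▸ one_sub_pow_lt_half hk hp) γ hγ δ hδ Ω μ ξ u
    hattack.measurable_time
    (fun t => (measureReal_preimage_zero_of_isProbabilisticAttack hattack t).ge) hattack.iIndep
    hinput hindep ((mul_max_log_one_div_le hK.le (by positivity) hδ.1
      (by exact_mod_cast hr)).trans hT)).imp_right fun hprob =>
    hprob.trans (measureReal_mono fun ω hω =>
      hω n r A B C D (x0 ω) (fun j => w j ω) fun t => hattack.eq_zero t ω)
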